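/- Setting. Let $N\ge 1$ agents $i\in\{1,\dots,N\}$ be given by $\dot x_i = h_i(x_i)+u_i$, $y_i = E x_i$, with $x_i\in\mathbb R^n$, each $h_i:\mathbb R^n\to\mathbb R^n$ globally Lipschitz, and $E\in\mathbb R^{q\times n}$ of full row rank. They communicate over an undirected connected graph with neighbour sets $\mathcal N_i$ and Laplacian $\mathfrak L$. Let the columns of $Z\in\mathbb R^{n\times(n-q)}$, $W\in\mathbb R^{n\times q}$, $R\in\mathbb R^{N\times(N-1)}$ be orthonormal bases of $\ker E$, $(\ker E)^\perp$, $\ker 1_N^\top$, where $1_N$ is the all-ones vector. Put $K=EWW^\top E^\top$. With gains $\kappa,k_P,k_I>0$ the coupling is $\dot\xi_i=-\kappa K\sum_{j\in\mathcal N_i}(y_j-y_i)$, $\xi_i\in\mathbb R^q$, together with either (A) $u_i=k_PE^\top\sum_{j\in\mathcal N_i}(y_j-y_i)+k_IE^\top\sum_{j\in\mathcal N_i}(\xi_j-\xi_i)$, or (B) $u_i=k_PE^\top\sum_{j\in\mathcal N_i}(y_j-y_i)-k_IE^\top\xi_i$ with $\sum_i\xi_i(0)=0$. Let $\Lambda_P=R^\top\mathfrak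 LR$, and let $\Lambda_I=\Lambda_P$ in case (A), $\Lambda_I=I_{N-1}$ in case (B). A point is called a globally exponentially stable equilibrium with rate $r$ if it is an equilibrium and there is a constant $c$ such that, for all solutions on $[0,\infty)$ and all $t\ge0$, the Euclidean distance to it at time $t$ is at most $ce^{-rt}$ times the distance at time $0$. Assumption. The blended dynamics $$\dot z_i=Z^\top h_i(Zz_i+W\bar w)\ (1\le i\le N),\qquad \dot{\bar w}=\tfrac1N\sum_{i=1}^NW^\top h_i(Zz_i+W\bar w)$$ has a (necessarily unique) globally exponentially stable equilibrium $(z_1^*,\dots,z_N^*,\bar w^*)$ with rate $\mu>0$. Write $z^*=[z_1^*;\dots;z_N^*]$, $h(x)=[h_1(x_1);\dots;h_N(x_N)]$, $x_i^*=Zz_i^*+W\bar w^*$, $x^*=[x_1^*;\dots;x_N^*]$, and $\widetilde\xi^*=\frac1{k_I}(\Lambda_I\otimes W^\top E^\top)^{-1}(R^\top\otimes W^\top)h(x^*)$. In the error coordinates $z_\delta=(I_N\otimes Z^\top)x-z^*$, $\bar w_\delta=\frac1N\sum_iW^\top x_i-\bar w^*$, $\widetilde w=(R^\top\otimes W^\top)x$,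 $\widetilde\xi_\delta=(R^\top\otimes I_q)\xi-\widetilde\xi^*$, the closed loop becomes the system $$\begin{aligned}\dot z_\delta&=(I_N\otimes Z^\top)h(x),\qquad \dot{\bar w}_\delta=\tfrac1N(1_N^\top\otimes W^\top)h(x),\\ \dot{\widetilde w}&=(R^\top\otimes W^\top)(h(x)-h(x^*))-k_P(\Lambda_P\otimes W^\top E^\top EW)\widetilde w-k_I(\Lambda_I\otimes W^\top E^\top)\widetilde\xi_\delta,\\ \dot{\widetilde\xi}_\delta&=\kappa(\Lambda_P\otimes KEW)\widetilde w,\end{aligned}\tag{1}$$ where $x=(I_N\otimes Z)(z_\delta+z^*)+(1_N\otimes W)(\bar w_\delta+\bar w^*)+(R\otimes W)\widetilde w$. Theorem. In each of the cases (A) and (B): (a) For all $\kappa,k_I>0$ with $2\kappa>k_I$ there is $k_P^*(\kappa,k_I)>0$ such that, for each $k_P>k_P^*$, the origin of (1) is globally exponentially stable with some rate $r>0$, and along every trajectory of the closed loop each $x_i(t)$ converges to $x_i^*=Zz_i^*+W\bar w^*$ exponentially fast, with rate $r$. (b) There is $\phi_0>0$ such that, for every $\phi^*\in(0,\phi_0)$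 and every $0<\upsilon<\mu$, there is $k_P^{**}(\upsilon,\phi^*)>0$ such that, for each $k_P>k_P^{**}$ and with $\kappa=k_I=\phi^*k_P$, the origin of (1) is globally exponentially stable with rate $\mu-\upsilon$: for a constant $\bar c$ and all solutions, $$\bigl|[z_\delta(t);\bar w_\delta(t);\widetilde w(t);\widetilde\xi_\delta(t)]\bigr|\le\bar c\,e^{-(\mu-\upsilon)t}\bigl|[z_\delta(0);\bar w_\delta(0);\widetilde w(0);\widetilde\xi_\delta(0)]\bigr|\qquad(t\ge0),$$ and along every trajectory of the closed loop each $x_i(t)$ converges to $x_i^*$ exponentially fast with rate at least $\mu-\upsilon$. If $N\ge2$ and $q\ge1$ one may take, with $\sigma_m,\sigma_M$ the smallest and largest singular values, $$\phi_0=\min\Bigl\{\sqrt2\sqrt{\tfrac{\sigma_m(\Lambda_P)}{\sigma_M(\Lambda_I)}},\ \tfrac{\sigma_M(\Lambda_P)}{\sigma_M(\Lambda_I)}\sigma_M(E),\ \tfrac2{\sigma_M(E)},\ \tfrac{\sigma_m(\Lambda_P)\sigma_m^2(E)}{\sqrt{\sigma_M(\Lambda_P)\sigma_M(\Lambda_I)}\,\sigma_M^2(E)}\Bigr\}.$$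 -/

import Mathlib

open Matrix Set

/-- Column stack `[x_1; …; x_a]` of `a` vectors of `ℝ^b`, with the Euclidean norm of `ℝ^{ab}`. -/
abbrev Stack (a b : ℕ) : Type := PiLp 2 (fun _ : Fin a => EuclideanSpace ℝ (Fin b))

/-- Matrix times vector, between Euclidean spaces. -/
noncomputable abbrev mv {a b : ℕ} (A : Matrix (Fin a) (Fin b) ℝ) (v : EuclideanSpace ℝ (Fin b)) :
    EuclideanSpace ℝ (Fin a) :=
  Matrix.toEuclideanLin A v

/-- `(A ⊗ B) x` for a stacked vector `x`: the `i`-th block is `∑ j, A i j • B x_j`. -/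
noncomputable def kron {a b c d : ℕ} (A : Matrix (Fin a) (Fin b) ℝ) (B : Matrix (Fin c) (Fin d) ℝ)
    (x : Stack b d) : Stack a c :=
  WithLp.toLp 2 (fun i => ∑ j, A i j • mv B (x j))

/-- The columns of `A` form an orthonormal basis of the subspace `S`. -/
def ColumnsONB {a b : ℕ} (A : Matrix (Fin a) (Fin b) ℝ)
    (S : Submodule ℝ (EuclideanSpace ℝ (Fin a))) : Prop :=
  Orthonormal ℝ (fun j : Fin b => WithLp.toLp 2 (A.col j)) ∧
    Submodule.span ℝ (range (fun j : Fin b => WithLp.toLp 2 (A.col j))) = S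

/-- Largest singular value. -/
noncomputable def sigmaMax {a b : ℕ} (A : Matrix (Fin a) (Fin b) ℝ) : ℝ :=
  (Matrix.toEuclideanLin A).singularValues 0

/-- Smallest of the `min a b` singular values of an `a × b` matrix (used for `a, b ≥ 1`;
Mathlib lists the singular values in decreasing order, starting from index `0`). -/
noncomputable def sigmaMin {a b : ℕ} (A : Matrix (Fin a) (Fin b) ℝ) : ℝ :=
  (Matrix.toEuclideanLin A).singularValues (min a b - 1)

/-- The point `e` is an equilibrium of `γ' = f(γ)` and is globally exponentially stable with
rate `r`: every solution on `[0, ∞)` satisfies `|γ(t) - e| ≤ c exp(-r t) |γ(0) - e|`, with a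
constant `c` that does not depend on the solution. -/
def GloballyExpStable {X : Type*} [NormedAddCommGroup X] [NormedSpace ℝ X]
    (f : X → X) (e : X) (r : ℝ) : Prop :=
  f e = 0 ∧ ∃ c : ℝ, 0 < c ∧ ∀ γ : ℝ → X, IsIntegralCurveOn γ (fun _ => f) (Ici 0) →
    ∀ t : ℝ, 0 ≤ t → ‖γ t - e‖ ≤ c * Real.exp (-r * t) * ‖γ 0 - e‖

/-- The two PI couplings: (A) sends both `y` and `ξ` to the neighbours, (B) sends only `y`. -/
inductive Coupling : Type
  | A : Coupling
  | B : Coupling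

/-- Data of the multi-agent system `x_i' = h_i(x_i) + u_i`, `y_i = E x_i` on a graph, together with
the matrices `Z`, `W`, `R` of the coordinate change. -/
structure MultiAgent (N n q : ℕ) where
  graph : SimpleGraph (Fin N)
  h : Fin N → EuclideanSpace ℝ (Fin n) → EuclideanSpace ℝ (Fin n)
  E : Matrix (Fin q) (Fin n) ℝ
  Z : Matrix (Fin n) (Fin (n - q)) ℝ
  W : Matrix (Fin n) (Fin q) ℝ
  R : Matrix (Fin N) (Fin (N - 1)) ℝ

/-- The state `e = [z; w̄]` of the blended dynamics. -/
abbrev BlendedState (N n q : ℕ) : Type :=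
  WithLp 2 (Stack N (n - q) × EuclideanSpace ℝ (Fin q))

/-- The state `[e; w̃; ξ̃]` of the transformed system. -/
abbrev ErrorState (N n q : ℕ) : Type :=
  WithLp 2 (BlendedState N n q × WithLp 2 (Stack (N - 1) q × Stack (N - 1) q))

namespace MultiAgent

variable {N n q : ℕ} (S : MultiAgent N n q)

/-- `K = E W Wᵀ Eᵀ`. -/
def K : Matrix (Fin q) (Fin q) ℝ := S.E * S.W * S.Wᵀ * S.Eᵀ

/-- `∑_{j ∈ N_i} (v_j - v_i)`. -/
noncomputable def diffuse {d : ℕ} (v : Fin N → EuclideanSpace ℝ (Fin d)) (i : Fin N) :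
    EuclideanSpace ℝ (Fin d) :=
  open Classical in ∑ j ∈ S.graph.neighborFinset i, (v j - v i)

/-- The coupling input `u_i`. -/
noncomputable def input (C : Coupling) (kP kI : ℝ) (x : Stack N n) (ξ : Stack N q) (i : Fin N) :
    EuclideanSpace ℝ (Fin n) :=
  match C with
  | .A => kP • mv S.Eᵀ (S.diffuse (fun j => mv S.E (x j)) i)
            + kI • mv S.Eᵀ (S.diffuse (fun j => ξ j) i)
  | .B => kP • mv S.Eᵀ (S.diffuse (fun j => mv S.E (x j)) i) - kI • mv S.Eᵀ (ξ i)

/-- `(x, ξ)` is a trajectory on `[0, ∞)` of the agents under the PI coupling; for (B) the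
initialization `∑ ξ_i(0) = 0` is required. -/
def IsTrajectory (C : Coupling) (κ kP kI : ℝ) (x : ℝ → Stack N n) (ξ : ℝ → Stack N q) : Prop :=
  (∀ t : ℝ, 0 ≤ t → ∀ i : Fin N,
    HasDerivWithinAt (fun s => x s i) (S.h i (x t i) + S.input C kP kI (x t) (ξ t) i) (Ici 0) t ∧
    HasDerivWithinAt (fun s => ξ s i)
      (-(κ • mv S.K (S.diffuse (fun j => mv S.E (x t j)) i))) (Ici 0) t) ∧
  (C = .B → ∑ i, ξ 0 i = 0)

/-- The blended dynamics `z_i' = Zᵀ h_i(Z z_i + W w̄)`, `w̄' = (1/N) ∑ Wᵀ h_i(Z z_i + W w̄)`. -/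
noncomputable def blended (e : BlendedState N n q) : BlendedState N n q :=
  WithLp.toLp 2
    (WithLp.toLp 2 (fun i => mv S.Zᵀ (S.h i (mv S.Z (e.fst i) + mv S.W e.snd))),
      (1 / (N : ℝ)) • ∑ i, mv S.Wᵀ (S.h i (mv S.Z (e.fst i) + mv S.W e.snd)))

/-- `h(x) = [h_1(x_1); …; h_N(x_N)]`. -/
noncomputable def hStack (x : Stack N n) : Stack N n := WithLp.toLp 2 (fun i => S.h i (x i))

/-- `x* = (I ⊗ Z) z* + (1 ⊗ W) w̄*`, for `e* = [z*; w̄*]`. -/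
noncomputable def xStar (es : BlendedState N n q) : Stack N n :=
  WithLp.toLp 2 (fun i => mv S.Z (es.fst i) + mv S.W es.snd)

/-- The graph Laplacian. -/
noncomputable def lap : Matrix (Fin N) (Fin N) ℝ :=
  open Classical in S.graph.lapMatrix ℝ

/-- `Λ_P = Rᵀ L R`. -/
noncomputable def lamP : Matrix (Fin (N - 1)) (Fin (N - 1)) ℝ := S.Rᵀ * S.lap * S.R

/-- `Λ_I` is `Λ_P` for (A) and the identity for (B). -/
noncomputable def lamI : Coupling → Matrix (Fin (N - 1)) (Fin (N - 1)) ℝ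
  | .A => S.lamP
  | .B => 1

/-- The state `x = (I ⊗ Z)(z_δ + z*) + (1 ⊗ W)(w̄_δ + w̄*) + (R ⊗ W) w̃`. -/
noncomputable def xOf (es : BlendedState N n q) (v : ErrorState N n q) : Stack N n :=
  S.xStar (v.fst + es) + kron S.R S.W v.snd.fst

/-- The vector field of the transformed system in the error coordinates
`[z_δ; w̄_δ; w̃; ξ̃_δ]`. -/
noncomputable def errorField (C : Coupling) (κ kP kI : ℝ) (es : BlendedState N n q)
    (v : ErrorState N n q) : ErrorState N n q :=
  WithLp.toLp 2
    (WithLp.toLp 2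
      (WithLp.toLp 2 (fun i => mv S.Zᵀ (S.h i (S.xOf es v i))),
        (1 / (N : ℝ)) • ∑ i, mv S.Wᵀ (S.h i (S.xOf es v i))),
     WithLp.toLp 2
      (kron S.Rᵀ S.Wᵀ (S.hStack (S.xOf es v) - S.hStack (S.xStar es))
          - kP • kron S.lamP (S.Wᵀ * S.Eᵀ * S.E * S.W) v.snd.fst
          - kI • kron (S.lamI C) (S.Wᵀ * S.Eᵀ) v.snd.snd,
        κ • kron S.lamP (S.K * S.E * S.W) v.snd.fst))

/-- `ξ̃* = (1/k_I) (Λ_I ⊗ Wᵀ Eᵀ)⁻¹ (Rᵀ ⊗ Wᵀ) h(x*)`. -/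
noncomputable def xiTildeStar (C : Coupling) (kI : ℝ) (es : BlendedState N n q) :
    Stack (N - 1) q :=
  (1 / kI) • kron (S.lamI C)⁻¹ (S.Wᵀ * S.Eᵀ)⁻¹ (kron S.Rᵀ S.Wᵀ (S.hStack (S.xStar es)))

/-- The error coordinates of a state `(x, ξ)` of the coupled agents: `z_δ = (I ⊗ Zᵀ) x - z*`,
`w̄_δ = (1/N) ∑ Wᵀ x_i - w̄*`, `w̃ = (Rᵀ ⊗ Wᵀ) x`, `ξ̃_δ = (Rᵀ ⊗ I) ξ - ξ̃*`. -/
noncomputable def errorCoord (C : Coupling) (kI : ℝ) (es : BlendedState N n q)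
    (x : Stack N n) (ξ : Stack N q) : ErrorState N n q :=
  WithLp.toLp 2
    (WithLp.toLp 2
      (WithLp.toLp 2 (fun i => mv S.Zᵀ (x i) - es.fst i),
        (1 / (N : ℝ)) • ∑ i, mv S.Wᵀ (x i) - es.snd),
     WithLp.toLp 2
      (kron S.Rᵀ S.Wᵀ x,
        kron S.Rᵀ (1 : Matrix (Fin q) (Fin q) ℝ) ξ - S.xiTildeStar C kI es))

/-- Along every trajectory of the coupled agents the error coordinates, and the distances of the
`x_i` to the `x_i*`, decay exponentially with rate `r`, with one constant for all trajectories. -/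
def TrajectoriesConverge (C : Coupling) (κ kP kI : ℝ) (es : BlendedState N n q) (r : ℝ) : Prop :=
  ∃ c : ℝ, 0 < c ∧ ∀ (x : ℝ → Stack N n) (ξ : ℝ → Stack N q), S.IsTrajectory C κ kP kI x ξ →
    ∀ t : ℝ, 0 ≤ t →
      ‖S.errorCoord C kI es (x t) (ξ t)‖
          ≤ c * Real.exp (-r * t) * ‖S.errorCoord C kI es (x 0) (ξ 0)‖ ∧
      ∀ i : Fin N, ‖x t i - S.xStar es i‖
          ≤ c * Real.exp (-r * t) * ‖S.errorCoord C kI es (x 0) (ξ 0)‖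

/-- The explicit upper bound on the ratio `φ* = k_I / k_P`. -/
noncomputable def phiBound (C : Coupling) : ℝ :=
  min (min (√2 * √(sigmaMin S.lamP / sigmaMax (S.lamI C)))
      (sigmaMax S.lamP / sigmaMax (S.lamI C) * sigmaMax S.E))
    (min (2 / sigmaMax S.E)
      (sigmaMin S.lamP * sigmaMin S.E ^ 2 /
        (√(sigmaMax S.lamP * sigmaMax (S.lamI C)) * sigmaMax S.E ^ 2)))

end MultiAgent

/-!
Stability of the PI-coupled agents follows from viewing the error system as a feedback
interconnection of the blended dynamics with a linear system.

Put `M = Wᵀ Eᵀ E W` and `η = (I ⊗ Wᵀ Eᵀ) ξ̃_δ`. The disagreement part reads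
`w̃' = p - k_P (Λ_P ⊗ M) w̃ - k_I (Λ_I ⊗ I) η` and `η' = κ (Λ_P ⊗ M²) w̃`, where `p` is bounded by the
sizes of the blended error and of `w̃`; the blended part is the blended dynamics perturbed by a term
bounded by the size of `w̃`. The matrices `Λ_P`, `Λ_I` and `M` are positive definite: `Λ_P` because
the graph is connected and the columns of `R` are orthogonal to `1_N`, and `M` because `E W` is
invertible.

The `h_i` are only Lipschitz, so the converse Lyapunov function of the blended dynamics is taken
nonsmooth: `V x = sup_t exp (ρ t) |φ_t x - e|` is Lipschitz and decays with any prescribed rate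
`ρ < μ` (`GloballyExpStable.exists_lyapunov`). For the linear part, with gains `k_P = k` and
`κ`, `k_I` proportional to a scalar `s ≤ k`, the quadratic form
`⟪Q w, w⟫ + ⟪J η, η⟫ + 2 ε (s / k) ⟪w, η⟫` dissipates `w` at order `k` and `η` at order `s² / k`.
The sum of `V²` and this form decays with every rate `r ≤ μ - υ` such that `r = O(s² / k)`, once
`k` is large (`exists_gain_interconnection_decay`). The choice `s = 1` gives part (a), with a rate
of order `1 / k_P`; the choice `s = k` gives part (b), with the rate `μ - υ`. The estimate holds
for all positive proportionality constants, in particular for every ratio `φ` of the gains.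

Trajectories of the coupled agents are solutions of the error system in the error coordinates
(`MultiAgent.IsAdapted.isIntegralCurveOn_errorCoord`), and the state is recovered from them by
`xOf` (`MultiAgent.IsAdapted.xOf_errorCoord`), which transfers the decay to the agents.
-/

open scoped Topology NNReal

/-! ### Lipschitz flows and a converse Lyapunov function -/

section FlowLipschitz

variable {X : Type*} [NormedAddCommGroup X] [NormedSpace ℝ X]

theorem LipschitzWith.exists_local_solution [CompleteSpace X] {f : X → X} {L : ℝ≥0}
    (hf : LipschitzWith L f) (x : X) :
    ∃ α : ℝ → X, α 0 = x ∧ ∀ t ∈ Icc (0 : ℝ) (1 / (2 * L + 1)),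
      HasDerivWithinAt α (f (α t)) (Icc 0 (1 / (2 * L + 1))) t := by
  set T : ℝ := 1 / (2 * L + 1) with hT
  have hT0 : 0 < T := by positivity
  have hLT : (L : ℝ) * T ≤ 1 / 2 := by
    rw [hT, mul_one_div, div_le_div_iff₀ (by positivity) (by norm_num)]
    linarith
  have hpl : IsPicardLindelof (fun _ : ℝ => f) (⟨0, le_rfl, hT0.le⟩ : Icc (0 : ℝ) T) x
      (2 * ‖f x‖₊ * T.toNNReal) 0 (‖f x‖₊ + L * (2 * ‖f x‖₊ * T.toNNReal)) L := by
    refine ⟨fun _ _ => hf.lipschitzOnWith, fun _ _ => continuousOn_const, fun _ _ y hy => ?_, ?_⟩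
    · have h1 := hf.dist_le_mul y x
      rw [Metric.mem_closedBall] at hy
      have h2 : ‖f y‖ ≤ ‖f x‖ + dist (f y) (f x) := by
        rw [dist_eq_norm]
        simpa using norm_add_le (f x) (f y - f x)
      push_cast at hy ⊢
      have h3 : (L : ℝ) * dist y x ≤ L * (2 * ‖f x‖ * (T.toNNReal : ℝ)) :=
        mul_le_mul_of_nonneg_left hy L.2
      linarith
    · simp only [NNReal.coe_add, NNReal.coe_mul, Real.coe_toNNReal _ hT0.le, coe_nnnorm,
        NNReal.coe_ofNat, sub_zero, NNReal.coe_zero, sub_self, max_eq_left hT0.le]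
      nlinarith [norm_nonneg (f x), mul_nonneg (norm_nonneg (f x)) hT0.le]
  exact hpl.exists_eq_forall_mem_Icc_hasDerivWithinAt₀

/-- A globally Lipschitz vector field has a solution on `[0, ∞)` through every point: the local
solutions live on intervals of a common length and are concatenated. -/
theorem LipschitzWith.exists_isIntegralCurveOn_Ici [CompleteSpace X] {f : X → X} {L : ℝ≥0}
    (hf : LipschitzWith L f) (x : X) :
    ∃ γ : ℝ → X, γ 0 = x ∧ IsIntegralCurveOn γ (fun _ => f) (Ici 0) := by
  choose Φ hΦ0 hΦ using fun y => hf.exists_local_solution y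
  set T : ℝ := 1 / (2 * L + 1) with hT
  have hT0 : 0 < T := by positivity
  -- the starting points of the successive pieces
  let p : ℕ → X := fun n => Nat.rec x (fun _ y => Φ y T) n
  have hp : ∀ n, p (n + 1) = Φ (p n) T := fun _ => rfl
  let γ : ℝ → X := fun t => Φ (p ⌊t / T⌋₊) (t - ⌊t / T⌋₊ * T)
  have hγ : ∀ n : ℕ, EqOn γ (fun t => Φ (p n) (t - n * T)) (Icc (n * T) ((n + 1) * T)) := by
    intro n t ht
    rcases ht.2.lt_or_eq with h | h
    · have : ⌊t / T⌋₊ = n := by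
        rw [Nat.floor_eq_iff (div_nonneg ((by positivity : 0 ≤ n * T).trans ht.1) hT0.le)]
        exact ⟨by rw [le_div_iff₀ hT0]; exact ht.1, by rw [div_lt_iff₀ hT0]; exact h⟩
      simp only [γ, this]
    · have : ⌊t / T⌋₊ = n + 1 := by
        rw [h, mul_div_cancel_right₀ _ hT0.ne']
        exact_mod_cast Nat.floor_natCast (n + 1)
      simp only [γ, this, hp]
      subst h
      push_cast
      rw [sub_self, hΦ0, show ((n : ℝ) + 1) * T - n * T = T by ring]
  have hd : ∀ n : ℕ, ∀ t ∈ Icc (n * T) ((n + 1) * T),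
      HasDerivWithinAt γ (f (γ t)) (Icc (n * T) ((n + 1) * T)) t := by
    intro n t ht
    have hmaps : MapsTo (fun s : ℝ => s - n * T) (Icc (n * T) ((n + 1) * T)) (Icc 0 T) := by
      intro s hs
      exact ⟨by linarith [hs.1], by linarith [hs.2]⟩
    have h1 := (hΦ (p n) (t - n * T) (hmaps ht)).scomp t
      ((hasDerivWithinAt_id t _).sub_const (n * T)) hmaps
    rw [one_smul] at h1
    rw [hγ n ht]
    exact h1.congr (hγ n) (hγ n ht)
  refine ⟨γ, by simp [γ, p, hΦ0], fun t ht => ?_⟩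
  rw [mem_Ici] at ht
  set n := ⌊t / T⌋₊ with hn
  have h1 : n * T ≤ t := by
    rw [← le_div_iff₀ hT0]; exact Nat.floor_le (div_nonneg ht hT0.le)
  have h2 : t < (n + 1) * T := by
    rw [← div_lt_iff₀ hT0]; exact Nat.lt_floor_add_one _
  have hdn := hd n t ⟨h1, h2.le⟩
  rcases h1.lt_or_eq with h | h
  · exact (hdn.hasDerivAt (Icc_mem_nhds h h2)).hasDerivWithinAt
  · rcases Nat.eq_zero_or_pos n with h0 | h0
    · rw [h0] at h hdn
      simp only [Nat.cast_zero, zero_mul, zero_add, one_mul] at h hdn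
      subst h
      exact hdn.mono_of_mem_nhdsWithin (Icc_mem_nhdsGE hT0)
    · obtain ⟨m, hm⟩ := Nat.exists_eq_succ_of_ne_zero h0.ne'
      have hm' : (n : ℝ) = m + 1 := by rw [hm]; push_cast; rfl
      have h3 := hd m t ⟨by rw [← h, hm']; nlinarith, by rw [← h, hm']⟩
      refine ((h3.union hdn).hasDerivAt ?_).hasDerivWithinAt
      rw [hm'] at h2 h ⊢
      rw [Icc_union_Icc_eq_Icc (by nlinarith) (by nlinarith)]
      exact Icc_mem_nhds (by nlinarith) h2

theorem IsIntegralCurveOn.hasDerivWithinAt_Ici {f : X → X} {γ : ℝ → X}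
    (h : IsIntegralCurveOn γ (fun _ => f) (Ici 0)) {t : ℝ} (ht : 0 ≤ t) :
    HasDerivWithinAt γ (f (γ t)) (Ici t) t :=
  (h t ht).mono (Ici_subset_Ici.2 ht)

theorem LipschitzWith.norm_sub_le_of_isIntegralCurveOn {f : X → X} {L : ℝ≥0}
    (hf : LipschitzWith L f) {γ δ : ℝ → X} (hγ : IsIntegralCurveOn γ (fun _ => f) (Ici 0))
    (hδ : IsIntegralCurveOn δ (fun _ => f) (Ici 0)) {t : ℝ} (ht : 0 ≤ t) :
    ‖γ t - δ t‖ ≤ ‖γ 0 - δ 0‖ * Real.exp (L * t) := by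
  have := dist_le_of_trajectories_ODE (v := fun _ => f) (a := 0) (b := t) (fun _ => hf)
    (hγ.continuousOn.mono Icc_subset_Ici_self) (fun s hs => hγ.hasDerivWithinAt_Ici hs.1)
    (hδ.continuousOn.mono Icc_subset_Ici_self) (fun s hs => hδ.hasDerivWithinAt_Ici hs.1)
    le_rfl t ⟨ht, le_rfl⟩
  simpa [dist_eq_norm] using this

theorem IsIntegralCurveOn.shift {f : X → X} {γ : ℝ → X}
    (h : IsIntegralCurveOn γ (fun _ => f) (Ici 0)) {s : ℝ} (hs : 0 ≤ s) :
    IsIntegralCurveOn (fun t => γ (s + t)) (fun _ => f) (Ici 0) := by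
  intro t ht
  have hst : s + t ∈ Ici (0 : ℝ) := add_nonneg hs ht
  have h1 := (h (s + t) hst).scomp t ((hasDerivWithinAt_id t (Ici 0)).const_add s)
    (fun u hu => add_nonneg hs hu)
  rwa [one_smul] at h1

/-- Converse Lyapunov theorem for a globally Lipschitz field: if the equilibrium `e` is globally
exponentially stable with rate `μ`, then for each `ρ < μ` there is a globally Lipschitz `V`,
comparable to the distance to `e`, that decays with rate `ρ` along all solutions. It is
`V x = sup_{t ≥ 0} exp (ρ t) |φ_t x - e|`; the supremum is attained on a compact interval of times
that does not depend on `x`, which is where its Lipschitz continuity comes from. -/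
theorem GloballyExpStable.exists_lyapunov [CompleteSpace X] {f : X → X} {e : X} {μ ρ : ℝ}
    {L : ℝ≥0} (hf : LipschitzWith L f) (h : GloballyExpStable f e μ) (hρ : 0 ≤ ρ) (hρμ : ρ < μ) :
    ∃ (V : X → ℝ) (c : ℝ), 0 < c ∧ (∀ x, ‖x - e‖ ≤ V x) ∧ (∀ x, V x ≤ c * ‖x - e‖) ∧
      (∀ x y, V x ≤ V y + c * ‖x - y‖) ∧
      ∀ x, ∃ γ : ℝ → X, γ 0 = x ∧ IsIntegralCurveOn γ (fun _ => f) (Ici 0) ∧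
        ∀ t, 0 ≤ t → V (γ t) ≤ Real.exp (-ρ * t) * V x := by
  obtain ⟨-, c, hc, hstab⟩ := h
  choose φ hφ0 hφ using fun x => hf.exists_isIntegralCurveOn_Ici x
  have hstab' : ∀ x t, 0 ≤ t → ‖φ x t - e‖ ≤ c * Real.exp (-μ * t) * ‖x - e‖ := by
    intro x t ht
    simpa [hφ0] using hstab (φ x) (hφ x) t ht
  have hunif : ∀ x t, 0 ≤ t →
      Real.exp (ρ * t) * ‖φ x t - e‖ ≤ c * Real.exp (-(μ - ρ) * t) * ‖x - e‖ := by
    intro x t ht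
    calc Real.exp (ρ * t) * ‖φ x t - e‖
        ≤ Real.exp (ρ * t) * (c * Real.exp (-μ * t) * ‖x - e‖) := by gcongr; exact hstab' x t ht
      _ = c * (Real.exp (ρ * t) * Real.exp (-μ * t)) * ‖x - e‖ := by ring
      _ = _ := by rw [← Real.exp_add]; ring_nf
  -- after time `T` the weighted distance is below its initial value
  obtain ⟨T, hT0, hT⟩ : ∃ T : ℝ, 0 ≤ T ∧ ∀ t, T ≤ t → c * Real.exp (-(μ - ρ) * t) ≤ 1 := by
    refine ⟨max 0 (Real.log c / (μ - ρ)), le_max_left _ _, fun t ht => ?_⟩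
    have h1 : Real.log c ≤ (μ - ρ) * t := by
      have := (le_max_right _ _).trans ht
      rw [div_le_iff₀ (by linarith)] at this
      linarith
    calc c * Real.exp (-(μ - ρ) * t) = Real.exp (Real.log c + -(μ - ρ) * t) := by
          rw [Real.exp_add, Real.exp_log hc]
      _ ≤ 1 := by rw [Real.exp_le_one_iff]; linarith
  let V : X → ℝ := fun x => ⨆ t : Icc (0 : ℝ) T, Real.exp (ρ * t) * ‖φ x t - e‖
  have hbound : ∀ x (t : Icc (0 : ℝ) T), Real.exp (ρ * t) * ‖φ x t - e‖ ≤ c * ‖x - e‖ := by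
    intro x t
    refine (hunif x t t.2.1).trans ?_
    have : Real.exp (-(μ - ρ) * t) ≤ 1 := by
      rw [Real.exp_le_one_iff]
      nlinarith [t.2.1]
    nlinarith [norm_nonneg (x - e), mul_nonneg hc.le (norm_nonneg (x - e))]
  have hbdd : ∀ x, BddAbove (range fun t : Icc (0 : ℝ) T => Real.exp (ρ * t) * ‖φ x t - e‖) :=
    fun x => ⟨c * ‖x - e‖, by rintro _ ⟨t, rfl⟩; exact hbound x t⟩
  have : Nonempty (Icc (0 : ℝ) T) := ⟨⟨0, le_rfl, hT0⟩⟩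
  have hlow : ∀ x, ‖x - e‖ ≤ V x := by
    intro x
    have := le_ciSup (hbdd x) ⟨0, le_rfl, hT0⟩
    simpa [hφ0] using this
  have hall : ∀ x t, 0 ≤ t → Real.exp (ρ * t) * ‖φ x t - e‖ ≤ V x := by
    intro x t ht
    rcases le_total t T with h | h
    · exact le_ciSup (hbdd x) ⟨t, ht, h⟩
    · refine (hunif x t ht).trans (le_trans ?_ (hlow x))
      nlinarith [hT t h, norm_nonneg (x - e)]
  have hsemi : ∀ x s t, 0 ≤ s → 0 ≤ t → φ (φ x s) t = φ x (s + t) := by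
    intro x s t hs ht
    have := hf.norm_sub_le_of_isIntegralCurveOn (hφ (φ x s)) ((hφ x).shift hs) ht
    simp only [hφ0, add_zero, sub_self, norm_zero, zero_mul] at this
    exact sub_eq_zero.1 (norm_le_zero_iff.1 this)
  refine ⟨V, max c (Real.exp ((ρ + L) * T)), lt_max_of_lt_left hc, hlow, fun x => ?_,
    fun x y => ?_, fun x => ⟨φ x, hφ0 x, hφ x, fun s hs => ?_⟩⟩
  · exact (ciSup_le (hbound x)).trans (by gcongr; exact le_max_left _ _)
  · refine ciSup_le fun t => ?_
    have h1 : ‖φ x t - e‖ ≤ ‖φ x t - φ y t‖ + ‖φ y t - e‖ := by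
      simpa using norm_add_le (φ x t - φ y t) (φ y t - e)
    have h2 := hf.norm_sub_le_of_isIntegralCurveOn (hφ x) (hφ y) t.2.1
    rw [hφ0, hφ0] at h2
    have h3 : Real.exp (ρ * t) * Real.exp (L * t) ≤ max c (Real.exp ((ρ + L) * T)) := by
      rw [← Real.exp_add, ← add_mul]
      refine le_trans ?_ (le_max_right _ _)
      gcongr
      exact t.2.2
    calc Real.exp (ρ * t) * ‖φ x t - e‖
        ≤ Real.exp (ρ * t) * (‖x - y‖ * Real.exp (L * t) + ‖φ y t - e‖) := by gcongr; linarith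
      _ = Real.exp (ρ * t) * ‖φ y t - e‖ + Real.exp (ρ * t) * Real.exp (L * t) * ‖x - y‖ := by ring
      _ ≤ _ := by gcongr; exact hall y t t.2.1
  · refine ciSup_le fun t => ?_
    rw [hsemi x s t hs t.2.1]
    have := hall x (s + t) (add_nonneg hs t.2.1)
    calc Real.exp (ρ * t) * ‖φ x (s + t) - e‖
        = Real.exp (-ρ * s) * (Real.exp (ρ * (s + t)) * ‖φ x (s + t) - e‖) := by
          rw [← mul_assoc, ← Real.exp_add]; ring_nf
      _ ≤ _ := by gcongr

end FlowLipschitz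

/-! ### Decay of the interconnection -/

section InterconnectionLyapunov

/-- Comparison principle: a continuous function whose increments to the right of each time are
dominated by a differentiable function of derivative at most `-r` times its value decays with
rate `r`. -/
theorem le_mul_exp_of_right_majorant {Ψ : ℝ → ℝ} {r : ℝ} (hc : ContinuousOn Ψ (Ici 0))
    (hmaj : ∀ t, 0 ≤ t → ∃ (Θ : ℝ → ℝ) (Θ' : ℝ), Θ t = Ψ t ∧ (∀ z, t ≤ z → Ψ z ≤ Θ z) ∧
      HasDerivWithinAt Θ Θ' (Ici t) t ∧ Θ' ≤ -r * Ψ t) {t : ℝ} (ht : 0 ≤ t) :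
    Ψ t ≤ Ψ 0 * Real.exp (-r * t) := by
  have := le_gronwallBound_of_liminf_deriv_right_le (f := Ψ) (f' := fun t => -r * Ψ t)
    (δ := Ψ 0) (K := -r) (ε := 0) (a := 0) (b := t) (hc.mono Icc_subset_Ici_self)
    (fun x hx b hb => ?_) le_rfl (fun x _ => by simp) t ⟨ht, le_rfl⟩
  · simpa [gronwallBound_ε0] using this
  · obtain ⟨Θ, Θ', h0, hle, hd, hΘ'⟩ := hmaj x hx.1
    refine Filter.Eventually.frequently ?_
    have h1 := hasDerivWithinAt_iff_tendsto_slope.1 (hd.mono Ioi_subset_Ici_self)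
    rw [sdiff_singleton_eq_self self_notMem_Ioi] at h1
    filter_upwards [h1.eventually_lt_const (hΘ'.trans_lt hb), self_mem_nhdsWithin] with z hz hxz
    rw [mem_Ioi] at hxz
    rw [slope_def_field, div_eq_inv_mul] at hz
    refine lt_of_le_of_lt ?_ hz
    have : 0 ≤ (z - x)⁻¹ := inv_nonneg.2 (sub_nonneg.2 hxz.le)
    rw [h0]
    gcongr
    exact hle z hxz.le

/-- The norm is right differentiable at a zero of a right differentiable curve. -/
theorem HasDerivWithinAt.norm_of_eq_zero {X : Type*} [NormedAddCommGroup X] [NormedSpace ℝ X]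
    {g : ℝ → X} {g' : X} {x : ℝ} (hg : HasDerivWithinAt g g' (Ici x) x) (h0 : g x = 0) :
    HasDerivWithinAt (fun z => ‖g z‖) ‖g'‖ (Ici x) x := by
  have h1 := hasDerivWithinAt_iff_tendsto_slope.1 hg
  rw [hasDerivWithinAt_iff_tendsto_slope]
  refine h1.norm.congr' ?_
  filter_upwards [self_mem_nhdsWithin] with z hz
  have hxz : 0 ≤ (z - x)⁻¹ := inv_nonneg.2 (sub_nonneg.2 hz.1)
  simp only [slope, h0, vsub_eq_sub, sub_zero, norm_smul, norm_zero, smul_eq_mul, Real.norm_eq_abs,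
    abs_of_nonneg hxz]

/-- Young's inequality applied to every cross term of the derivative of the composite Lyapunov
function. -/
theorem composite_lyapunov_budget {a M υ ρ ε k s v W Y : ℝ} (ha : 0 < a) (hM : 1 ≤ M)
    (hυ : 0 < υ) (hε : 0 < ε) (hεM : ε * (4 * M ^ 2 / a + 2 * M) ≤ a / 2) (hk : 1 ≤ k)
    (hk1 : 16 * M ^ 4 / υ + 2 * M ^ 2 + a / 2 ≤ k * (a / 2)) (hk2 : a / 2 ≤ k * (υ / 4))
    (hs : 0 < s) (hsk : s ≤ k) :
    -2 * ρ * v ^ 2 + 4 * M ^ 2 * (v * W) + 2 * M ^ 2 * W ^ 2 - 2 * k * a * W ^ 2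
        + 2 * (ε * s / k) * (M * (v + W) * Y + k * (M * W * Y) - s * (a * Y ^ 2) + s * (M * W ^ 2))
      ≤ -(2 * ρ - υ / 2) * v ^ 2 - k * a * W ^ 2 - ε * a * s ^ 2 / k * Y ^ 2 := by
  have hk0 : 0 < k := by linarith
  have hM0 : 0 < M := by linarith
  have young : ∀ x y b : ℝ, 0 < b → 2 * (x * y) ≤ b * x ^ 2 + y ^ 2 / b := by
    intro x y b hb
    have : b * x ^ 2 + y ^ 2 / b - 2 * (x * y) = (b * x - y) ^ 2 / b := by field_simp; ring
    have : 0 ≤ (b * x - y) ^ 2 / b := by positivity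
    linarith
  have h1 : 4 * M ^ 2 * (v * W) ≤ υ / 4 * v ^ 2 + 16 * M ^ 4 / υ * W ^ 2 := by
    have := young v (2 * M ^ 2 * W) (υ / 4) (by positivity)
    have e : (2 * M ^ 2 * W) ^ 2 / (υ / 4) = 16 * M ^ 4 / υ * W ^ 2 := by field_simp; ring
    rw [e] at this
    linarith
  have h2 : ∀ x, 2 * (ε * s / k) * (M * x * Y)
      ≤ ε / k * (a / 4 * (s * Y) ^ 2 + 4 * M ^ 2 / a * x ^ 2) := by
    intro x
    have := young (s * Y) (M * x) (a / 4) (by positivity)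
    have e : (M * x) ^ 2 / (a / 4) = 4 * M ^ 2 / a * x ^ 2 := by field_simp
    rw [e] at this
    calc 2 * (ε * s / k) * (M * x * Y) = ε / k * (2 * (s * Y * (M * x))) := by ring
      _ ≤ _ := by gcongr
  have h3 : 2 * (ε * s / k) * (k * (M * W * Y))
      ≤ ε / k * (a / 4 * (s * Y) ^ 2) + ε * k * (4 * M ^ 2 / a * W ^ 2) := by
    have := young (s * Y) (k * M * W) (a / 4) (by positivity)
    calc 2 * (ε * s / k) * (k * (M * W * Y)) = ε / k * (2 * (s * Y * (k * M * W))) := by ring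
      _ ≤ ε / k * (a / 4 * (s * Y) ^ 2 + (k * M * W) ^ 2 / (a / 4)) := by gcongr
      _ = _ := by field_simp
  have h4 : 2 * (ε * s / k) * (s * (M * W ^ 2)) ≤ ε * k * (2 * M * W ^ 2) := by
    have e : s ^ 2 / k ≤ k := by
      rw [div_le_iff₀ hk0]; nlinarith
    calc 2 * (ε * s / k) * (s * (M * W ^ 2)) = s ^ 2 / k * (ε * (2 * M * W ^ 2)) := by ring
      _ ≤ k * (ε * (2 * M * W ^ 2)) := by gcongr
      _ = _ := by ring
  have h5 : ε * (4 * M ^ 2 / a) ≤ a / 2 := by nlinarith [mul_pos hε hM0]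
  have h6 : ∀ x, ε / k * (4 * M ^ 2 / a * x ^ 2) ≤ a / 2 / k * x ^ 2 := by
    intro x
    calc ε / k * (4 * M ^ 2 / a * x ^ 2) = ε * (4 * M ^ 2 / a) / k * x ^ 2 := by ring
      _ ≤ _ := by gcongr
  have h7 : a / 2 / k * v ^ 2 ≤ υ / 4 * v ^ 2 := by
    refine mul_le_mul_of_nonneg_right ?_ (sq_nonneg v)
    rw [div_le_iff₀ hk0]; linarith
  have h8 : a / 2 / k * W ^ 2 ≤ a / 2 * W ^ 2 := by
    exact mul_le_mul_of_nonneg_right (div_le_self (by positivity) hk) (sq_nonneg W)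
  have h9 : ε * k * (4 * M ^ 2 / a * W ^ 2) + ε * k * (2 * M * W ^ 2) ≤ k * (a / 2) * W ^ 2 := by
    calc _ = k * (ε * (4 * M ^ 2 / a + 2 * M)) * W ^ 2 := by ring
      _ ≤ _ := by gcongr
  have h10 := mul_le_mul_of_nonneg_right hk1 (sq_nonneg W)
  have h11 : 0 ≤ ε / k * (a * (s * Y) ^ 2) := by positivity
  have h12 : 2 * (ε * s / k) * (M * (v + W) * Y)
      = 2 * (ε * s / k) * (M * v * Y) + 2 * (ε * s / k) * (M * W * Y) := by ring
  have h13 : 2 * (ε * s / k) * (s * (a * Y ^ 2)) = 2 * (ε / k * (a * (s * Y) ^ 2)) := by ring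
  have h14 : ε * a * s ^ 2 / k * Y ^ 2 = ε / k * (a * (s * Y) ^ 2) := by ring
  have h15 := h2 v
  have h16 := h2 W
  have h17 := h6 v
  have h18 := h6 W
  rw [h14]
  rw [mul_add (ε / k)] at h15 h16
  have h19 : ε / k * (a / 4 * (s * Y) ^ 2) = 1 / 4 * (ε / k * (a * (s * Y) ^ 2)) := by ring
  rw [h19] at h15 h16 h3
  simp only [mul_add, mul_sub] at h12 h13 ⊢
  linarith

variable {X H : Type*} [NormedAddCommGroup X] [NormedSpace ℝ X]
  [NormedAddCommGroup H] [InnerProductSpace ℝ H]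

/-- The quadratic form `⟪Q w, w⟫ + ⟪J η, η⟫ + 2 δ ⟪w, η⟫` on pairs `(w, η)`. -/
noncomputable def crossEnergy (J Q : H →L[ℝ] H) (δ : ℝ) (w η : H) : ℝ :=
  inner ℝ (Q w) w + inner ℝ (J η) η + 2 * δ * inner ℝ w η

theorem abs_inner_apply_le {A : H →L[ℝ] H} {M : ℝ} (hA : ‖A‖ ≤ M) (u v : H) :
    |inner ℝ (A u) v| ≤ M * ‖u‖ * ‖v‖ := by
  refine (abs_real_inner_le_norm _ _).trans ?_
  gcongr
  exact (A.le_opNorm u).trans (by gcongr)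

theorem le_crossEnergy {J Q : H →L[ℝ] H} {a δ : ℝ} (hJa : ∀ x, a * ‖x‖ ^ 2 ≤ inner ℝ (J x) x)
    (hQa : ∀ x, a * ‖x‖ ^ 2 ≤ inner ℝ (Q x) x) (hδ0 : 0 ≤ δ) (hδ : δ ≤ a / 2) (w η : H) :
    a / 2 * (‖w‖ ^ 2 + ‖η‖ ^ 2) ≤ crossEnergy J Q δ w η := by
  have h1 := hQa w
  have h2 := hJa η
  have h3 := neg_le_of_abs_le (abs_real_inner_le_norm w η)
  have h4 : 2 * δ * (‖w‖ * ‖η‖) ≤ a / 2 * (‖w‖ ^ 2 + ‖η‖ ^ 2) := by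
    calc 2 * δ * (‖w‖ * ‖η‖) ≤ 2 * (a / 2) * (‖w‖ * ‖η‖) := by gcongr
      _ ≤ _ := by nlinarith [sq_nonneg (‖w‖ - ‖η‖)]
  have h5 := mul_le_mul_of_nonneg_left h3 (by positivity : 0 ≤ 2 * δ)
  simp only [crossEnergy]
  linarith

theorem crossEnergy_le {J Q : H →L[ℝ] H} {M δ : ℝ} (hJ : ‖J‖ ≤ M) (hQ : ‖Q‖ ≤ M)
    (hδ0 : 0 ≤ δ) (hδ : δ ≤ M) (w η : H) :
    crossEnergy J Q δ w η ≤ 2 * M * (‖w‖ ^ 2 + ‖η‖ ^ 2) := by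
  have h1 := le_of_abs_le (abs_inner_apply_le hQ w w)
  have h2 := le_of_abs_le (abs_inner_apply_le hJ η η)
  have h4 : 2 * δ * inner ℝ w η ≤ M * (‖w‖ ^ 2 + ‖η‖ ^ 2) := by
    calc 2 * δ * inner ℝ w η ≤ 2 * δ * (‖w‖ * ‖η‖) := by gcongr; exact real_inner_le_norm w η
      _ ≤ 2 * M * (‖w‖ * ‖η‖) := by gcongr
      _ = M * (2 * ‖w‖ * ‖η‖) := by ring
      _ ≤ _ := mul_le_mul_of_nonneg_left (two_mul_le_add_sq _ _) (hδ0.trans hδ)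
  simp only [crossEnergy]
  linarith

/-- Along `w' = p - k P w - s J η`, `η' = s Q w` the terms `⟪Q w, J η⟫` cancel. -/
theorem hasDerivWithinAt_crossEnergy {P J Q : H →L[ℝ] H}
    (hJ : ∀ x y, inner ℝ (J x) y = inner ℝ x (J y))
    (hQ : ∀ x y, inner ℝ (Q x) y = inner ℝ x (Q y)) {w η : ℝ → H} {p : H} {k s δ τ : ℝ}
    {A : Set ℝ} (hw : HasDerivWithinAt w (p - k • P (w τ) - s • J (η τ)) A τ)
    (hη : HasDerivWithinAt η (s • Q (w τ)) A τ) :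
    HasDerivWithinAt (fun t => crossEnergy J Q δ (w t) (η t))
      (2 * inner ℝ (Q (w τ)) p - 2 * k * inner ℝ (Q (w τ)) (P (w τ))
        + 2 * δ * (inner ℝ p (η τ) - k * inner ℝ (P (w τ)) (η τ)
          - s * inner ℝ (J (η τ)) (η τ) + s * inner ℝ (Q (w τ)) (w τ))) A τ := by
  have hQw := Q.hasFDerivAt.comp_hasDerivWithinAt τ hw
  have hJη := J.hasFDerivAt.comp_hasDerivWithinAt τ hη
  refine (((hQw.inner ℝ hw).add (hJη.inner ℝ hη)).add
    ((hw.inner ℝ hη).const_mul (2 * δ))).congr_deriv ?_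
  set w' : H := p - k • P (w τ) - s • J (η τ) with hw'
  have e1 : inner ℝ (Q w') (w τ) = inner ℝ (Q (w τ)) w' := by rw [hQ, real_inner_comm]
  have e2 : inner ℝ (J (s • Q (w τ))) (η τ) = s * inner ℝ (Q (w τ)) (J (η τ)) := by
    rw [hJ, inner_smul_left]; rfl
  have e3 : inner ℝ (J (η τ)) (s • Q (w τ)) = s * inner ℝ (Q (w τ)) (J (η τ)) := by
    rw [inner_smul_right, real_inner_comm]
  have e4 : inner ℝ (Q (w τ)) w' = inner ℝ (Q (w τ)) p - k * inner ℝ (Q (w τ)) (P (w τ))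
      - s * inner ℝ (Q (w τ)) (J (η τ)) := by
    simp only [hw', inner_sub_right, inner_smul_right]
  have e5 : inner ℝ w' (η τ) = inner ℝ p (η τ) - k * inner ℝ (P (w τ)) (η τ)
      - s * inner ℝ (J (η τ)) (η τ) := by
    simp only [hw', inner_sub_left, inner_smul_left, RCLike.conj_to_real]
  have e6 : inner ℝ (w τ) (s • Q (w τ)) = s * inner ℝ (Q (w τ)) (w τ) := by
    rw [inner_smul_right, real_inner_comm]
  simp only [Function.comp_apply]
  rw [e1, e2, e3, e4, e5, e6]
  ring

theorem crossEnergy_deriv_le {P J Q : H →L[ℝ] H} {M a k s δ v : ℝ} (hP : ‖P‖ ≤ M)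
    (hQ : ‖Q‖ ≤ M) (hJa : ∀ x, a * ‖x‖ ^ 2 ≤ inner ℝ (J x) x)
    (hQPa : ∀ x, a * ‖x‖ ^ 2 ≤ inner ℝ (Q x) (P x)) (hM : 0 ≤ M) (hk : 0 ≤ k) (hs : 0 ≤ s)
    (hδ : 0 ≤ δ) {w η p : H} (hp : ‖p‖ ≤ M * (v + ‖w‖)) :
    2 * inner ℝ (Q w) p - 2 * k * inner ℝ (Q w) (P w)
        + 2 * δ * (inner ℝ p η - k * inner ℝ (P w) η - s * inner ℝ (J η) η + s * inner ℝ (Q w) w)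
      ≤ 2 * M ^ 2 * (v * ‖w‖) + 2 * M ^ 2 * ‖w‖ ^ 2 - 2 * k * a * ‖w‖ ^ 2
        + 2 * δ * (M * (v + ‖w‖) * ‖η‖ + k * (M * ‖w‖ * ‖η‖) - s * (a * ‖η‖ ^ 2)
          + s * (M * ‖w‖ ^ 2)) := by
  have b1 : inner ℝ (Q w) p ≤ M ^ 2 * (v * ‖w‖) + M ^ 2 * ‖w‖ ^ 2 := by
    calc inner ℝ (Q w) p ≤ M * ‖w‖ * ‖p‖ := le_of_abs_le (abs_inner_apply_le hQ _ _)
      _ ≤ M * ‖w‖ * (M * (v + ‖w‖)) := by gcongr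
      _ = _ := by ring
  have b3 : inner ℝ p η ≤ M * (v + ‖w‖) * ‖η‖ := (real_inner_le_norm p η).trans (by gcongr)
  have b6 : inner ℝ (Q w) w ≤ M * ‖w‖ ^ 2 := by
    simpa only [sq, mul_assoc] using le_of_abs_le (abs_inner_apply_le hQ w w)
  have c0 := mul_le_mul_of_nonneg_left (hQPa w) hk
  have c1 := mul_le_mul_of_nonneg_left (neg_le_of_abs_le (abs_inner_apply_le hP w η)) hk
  have c2 := mul_le_mul_of_nonneg_left (hJa η) hs
  have c3 := mul_le_mul_of_nonneg_left b6 hs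
  have c4 : inner ℝ p η - k * inner ℝ (P w) η - s * inner ℝ (J η) η + s * inner ℝ (Q w) w
      ≤ M * (v + ‖w‖) * ‖η‖ + k * (M * ‖w‖ * ‖η‖) - s * (a * ‖η‖ ^ 2) + s * (M * ‖w‖ ^ 2) := by
    linarith
  have c5 := mul_le_mul_of_nonneg_left c4 (by positivity : 0 ≤ 2 * δ)
  linarith

/-- Along a perturbed solution, `V` is dominated to the right of time `τ` by its decay along the
unperturbed solution issued from the same point, plus `c` times the distance of both solutions. -/
theorem exists_right_majorant {f : X → X} {V : X → ℝ} {c ρ τ : ℝ}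
    (hVlip : ∀ x y, V x ≤ V y + c * ‖x - y‖)
    (hVdec : ∀ x, ∃ γ : ℝ → X, γ 0 = x ∧ IsIntegralCurveOn γ (fun _ => f) (Ici 0) ∧
      ∀ t, 0 ≤ t → V (γ t) ≤ Real.exp (-ρ * t) * V x)
    {x : ℝ → X} {d : X} (hx : HasDerivWithinAt x (f (x τ) + d) (Ici τ) τ) :
    ∃ G : ℝ → ℝ, G τ = V (x τ) ∧ (∀ z, τ ≤ z → V (x z) ≤ G z) ∧
      HasDerivWithinAt G (-ρ * V (x τ) + c * ‖d‖) (Ici τ) τ := by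
  obtain ⟨γ, hγ0, hγ, hγV⟩ := hVdec (x τ)
  refine ⟨fun z => Real.exp (-ρ * (z - τ)) * V (x τ) + c * ‖x z - γ (z - τ)‖, by simp [hγ0],
    fun z hz => ?_, ?_⟩
  · have h1 := hVlip (x z) (γ (z - τ))
    have h2 := hγV (z - τ) (sub_nonneg.2 hz)
    linarith
  · have hγd : HasDerivWithinAt (fun z => γ (z - τ)) (f (x τ)) (Ici τ) τ := by
      have h1 : HasDerivWithinAt γ (f (x τ)) (Ici 0) (τ - τ) := by
        rw [sub_self, ← hγ0]
        exact hγ 0 self_mem_Ici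
      have h2 := h1.scomp (h := fun z => z - τ) τ
        ((hasDerivWithinAt_id τ (Ici τ)).sub_const τ) (fun z hz => mem_Ici.2 (sub_nonneg.2 hz))
      rwa [one_smul] at h2
    have hdiff : HasDerivWithinAt (fun z => ‖x z - γ (z - τ)‖) ‖d‖ (Ici τ) τ := by
      have h1 := (hx.sub hγd).norm_of_eq_zero (by simp [hγ0])
      simpa using h1
    have h1 : HasDerivWithinAt (fun z => Real.exp (-ρ * (z - τ))) (-ρ) (Ici τ) τ := by
      have := ((((hasDerivAt_id τ).sub_const τ).const_mul (-ρ)).exp).hasDerivWithinAt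
        (s := Ici τ)
      simpa using this
    exact (h1.mul_const _).add (hdiff.const_mul c)

set_option maxHeartbeats 400000 in
/-- The interconnection of an exponentially stable nonlinear system with a two-block linear system
`w' = p - k P w - s J η`, `η' = s Q w`, through Lipschitz couplings. The Lyapunov function is
`V x ^ 2 + ⟪Q w, w⟫ + ⟪J η, η⟫ + 2 ε (s / k) ⟪w, η⟫`, with `V` from the converse theorem: the first
two quadratic terms cancel the skew coupling of `w` and `η`, and the small cross term provides
dissipation in `η`, of order `s ^ 2 / k`. -/
theorem exists_gain_interconnection_decay [CompleteSpace X] {f : X → X} {e : X} {μ υ L₁ : ℝ} {L : ℝ≥0}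
    (hf : LipschitzWith L f) (hstab : GloballyExpStable f e μ) (hυ : 0 < υ) (hυμ : υ < μ)
    (P J Q : H →L[ℝ] H) (hJ : ∀ x y, inner ℝ (J x) y = inner ℝ x (J y))
    (hQ : ∀ x y, inner ℝ (Q x) y = inner ℝ x (Q y)) {a : ℝ} (ha : 0 < a)
    (hJa : ∀ x, a * ‖x‖ ^ 2 ≤ inner ℝ (J x) x) (hQa : ∀ x, a * ‖x‖ ^ 2 ≤ inner ℝ (Q x) x)
    (hQPa : ∀ x, a * ‖x‖ ^ 2 ≤ inner ℝ (Q x) (P x)) :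
    ∃ k₀ c₀ C : ℝ, 0 < k₀ ∧ 0 < c₀ ∧ 0 < C ∧ ∀ k s r : ℝ, k₀ < k → 0 < s → s ≤ k → 0 ≤ r →
      r ≤ μ - υ → r ≤ c₀ * s ^ 2 / k →
      ∀ (x d : ℝ → X) (w η p : ℝ → H),
        (∀ t, 0 ≤ t → HasDerivWithinAt x (f (x t) + d t) (Ici 0) t ∧
          HasDerivWithinAt w (p t - k • P (w t) - s • J (η t)) (Ici 0) t ∧
          HasDerivWithinAt η (s • Q (w t)) (Ici 0) t ∧
          ‖d t‖ ≤ L₁ * ‖w t‖ ∧ ‖p t‖ ≤ L₁ * (‖x t - e‖ + ‖w t‖)) →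
        ∀ t, 0 ≤ t → ‖x t - e‖ ^ 2 + ‖w t‖ ^ 2 + ‖η t‖ ^ 2 ≤
          C * Real.exp (-(2 * r) * t) * (‖x 0 - e‖ ^ 2 + ‖w 0‖ ^ 2 + ‖η 0‖ ^ 2) := by
  obtain ⟨V, c, hc, hVlow, hVup, hVlip, hVdec⟩ :=
    hstab.exists_lyapunov hf (ρ := μ - υ / 2) (by linarith) (by linarith)
  obtain ⟨M, hM1, hMc, hML, hMP, hMJ, hMQ⟩ :
      ∃ M : ℝ, 1 ≤ M ∧ c ≤ M ∧ L₁ ≤ M ∧ ‖P‖ ≤ M ∧ ‖J‖ ≤ M ∧ ‖Q‖ ≤ M := by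
    refine ⟨1 + c + |L₁| + ‖P‖ + ‖J‖ + ‖Q‖, ?_, ?_, ?_, ?_, ?_, ?_⟩ <;>
    linarith [norm_nonneg P, norm_nonneg J, norm_nonneg Q, abs_nonneg L₁, le_abs_self L₁]
  have hM0 : 0 < M := by linarith
  -- the weight of the cross term
  obtain ⟨ε, hε, hε1, hεM⟩ : ∃ ε : ℝ, 0 < ε ∧ ε ≤ 1 ∧ ε * (4 * M ^ 2 / a + 2 * M) ≤ a / 2 := by
    have hD : 0 < 4 * M ^ 2 / a + 2 * M := by positivity
    refine ⟨min 1 (a / 2 / (4 * M ^ 2 / a + 2 * M)), by positivity, min_le_left _ _, ?_⟩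
    rw [← le_div_iff₀ hD]
    exact min_le_right _ _
  have hεa : ε ≤ a / 2 := by
    have : 0 < 4 * M ^ 2 / a := by positivity
    nlinarith [mul_pos hε this]
  have hm : 0 < min 1 (a / 2) := by positivity
  refine ⟨1 + (16 * M ^ 4 / υ + 2 * M ^ 2 + a / 2) / (a / 2) + a / 2 / (υ / 4)
      + 4 * M * (μ - υ) / a, ε * a / (4 * M), (c ^ 2 + 2 * M) / min 1 (a / 2),
    ?_, by positivity, by positivity, ?_⟩
  · have : 0 < μ - υ := by linarith
    positivity
  intro k s r hk hs hsk hr hrμ hrs x d w η p hsol t ht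
  have hμυ : 0 < μ - υ := by linarith
  have q1 : 0 < (16 * M ^ 4 / υ + 2 * M ^ 2 + a / 2) / (a / 2) := by positivity
  have q2 : 0 < a / 2 / (υ / 4) := by positivity
  have q3 : 0 < 4 * M * (μ - υ) / a := by positivity
  have hk1 : 1 ≤ k := by linarith
  have hk2 : 16 * M ^ 4 / υ + 2 * M ^ 2 + a / 2 ≤ k * (a / 2) := by
    rw [← div_le_iff₀ (by positivity)]; linarith
  have hk3 : a / 2 ≤ k * (υ / 4) := by
    rw [← div_le_iff₀ (by positivity)]; linarith
  have hk4 : 4 * M * (μ - υ) ≤ k * a := by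
    rw [← div_le_iff₀ ha]; linarith
  have hk0 : 0 < k := by linarith
  set δ : ℝ := ε * s / k with hδ
  have hδ0 : 0 < δ := by positivity
  have hδε : δ ≤ ε := by
    rw [hδ, div_le_iff₀ hk0]; gcongr
  let U : ℝ → ℝ := fun t => crossEnergy J Q δ (w t) (η t)
  have hV0 : ∀ y, 0 ≤ V y := fun y => (norm_nonneg _).trans (hVlow y)
  have hUlow : ∀ t, a / 2 * (‖w t‖ ^ 2 + ‖η t‖ ^ 2) ≤ U t := fun t =>
    le_crossEnergy hJa hQa hδ0.le (hδε.trans hεa) _ _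
  have hUup : ∀ t, U t ≤ 2 * M * (‖w t‖ ^ 2 + ‖η t‖ ^ 2) := fun t =>
    crossEnergy_le hMJ hMQ hδ0.le (by linarith) _ _
  have hxc : ContinuousOn x (Ici 0) := fun t ht => (hsol t ht).1.continuousWithinAt
  have hwc : ContinuousOn w (Ici 0) := fun t ht => (hsol t ht).2.1.continuousWithinAt
  have hηc : ContinuousOn η (Ici 0) := fun t ht => (hsol t ht).2.2.1.continuousWithinAt
  have hVc : Continuous V :=
    (LipschitzWith.of_le_add_mul ⟨c, hc.le⟩
      (fun y z => by rw [dist_eq_norm]; exact hVlip y z)).continuous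
  have hΨc : ContinuousOn (fun t => V (x t) ^ 2 + U t) (Ici 0) := by
    have h1 : ContinuousOn (fun t => V (x t)) (Ici 0) := hVc.comp_continuousOn hxc
    have h2 : ContinuousOn U (Ici 0) := fun t ht =>
      (hasDerivWithinAt_crossEnergy hJ hQ (hsol t ht).2.1 (hsol t ht).2.2.1).continuousWithinAt
    exact (h1.pow 2).add h2
  have key : V (x t) ^ 2 + U t ≤ (V (x 0) ^ 2 + U 0) * Real.exp (-(2 * r) * t) := by
    refine le_mul_exp_of_right_majorant hΨc (fun τ hτ => ?_) ht
    obtain ⟨hx, hw, hη, hd, hp⟩ := hsol τ hτ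
    have hx := hx.mono (Ici_subset_Ici.2 hτ)
    have hw := hw.mono (Ici_subset_Ici.2 hτ)
    have hη := hη.mono (Ici_subset_Ici.2 hτ)
    obtain ⟨G, hGτ, hVG, hGd⟩ := exists_right_majorant hVlip hVdec hx
    have hUd := hasDerivWithinAt_crossEnergy (δ := δ) hJ hQ hw hη
    refine ⟨fun z => G z ^ 2 + U z, _, by simp only [hGτ], fun z hz => ?_,
      (hGd.pow 2).add hUd, ?_⟩
    · have := hVG z hz
      have h0 := hV0 (x z)
      exact add_le_add_left (pow_le_pow_left₀ h0 this 2) _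
    · rw [hGτ]
      set v := V (x τ) with hv
      set W := ‖w τ‖ with hW
      set Y := ‖η τ‖ with hY
      have hv0 : 0 ≤ v := hV0 _
      have hW0 : 0 ≤ W := norm_nonneg _
      have hY0 : 0 ≤ Y := norm_nonneg _
      have hdM : c * ‖d τ‖ ≤ M ^ 2 * W := by
        have : ‖d τ‖ ≤ M * W := hd.trans (by gcongr)
        calc c * ‖d τ‖ ≤ M * (M * W) := by gcongr
          _ = _ := by ring
      have hpM : ‖p τ‖ ≤ M * (v + W) := by
        refine hp.trans ?_
        gcongr
        exact hVlow _
      have b1 := crossEnergy_deriv_le hMP hMQ hJa hQPa hM0.le hk0.le hs.le hδ0.le hpM (η := η τ)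
      have b7 := composite_lyapunov_budget (ρ := μ - υ / 2) (v := v) (W := W) (Y := Y) ha hM1 hυ hε
        hεM hk1 hk2 hk3 hs hsk
      have b8 : 2 * v * (c * ‖d τ‖) ≤ 2 * v * (M ^ 2 * W) := by gcongr
      have b12 : 2 * r * U τ ≤ k * a * W ^ 2 + ε * a * s ^ 2 / k * Y ^ 2 := by
        have d1 : r * (4 * M) ≤ k * a := by
          calc r * (4 * M) ≤ (μ - υ) * (4 * M) := by gcongr
            _ ≤ k * a := by linarith
        have d2 : r * (4 * M) ≤ ε * a * s ^ 2 / k := by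
          calc r * (4 * M) ≤ ε * a / (4 * M) * s ^ 2 / k * (4 * M) := by gcongr
            _ = _ := by field_simp
        calc 2 * r * U τ ≤ 2 * r * (2 * M * (W ^ 2 + Y ^ 2)) := by gcongr; exact hUup τ
          _ = r * (4 * M) * W ^ 2 + r * (4 * M) * Y ^ 2 := by ring
          _ ≤ _ := by gcongr
      have b13 : 2 * r * v ^ 2 ≤ 2 * (μ - υ) * v ^ 2 := by gcongr
      have b14 : 0 ≤ υ / 2 * v ^ 2 := by positivity
      rw [← hδ] at b7
      simp only [Nat.add_one_sub_one, pow_one, Nat.cast_ofNat]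
      linarith
  have hlow : min 1 (a / 2) * (‖x t - e‖ ^ 2 + ‖w t‖ ^ 2 + ‖η t‖ ^ 2) ≤ V (x t) ^ 2 + U t := by
    have h1 : ‖x t - e‖ ^ 2 ≤ V (x t) ^ 2 := by gcongr; exact hVlow _
    have h2 := hUlow t
    have h3 : min 1 (a / 2) * ‖x t - e‖ ^ 2 ≤ 1 * ‖x t - e‖ ^ 2 := by
      gcongr; exact min_le_left _ _
    have h4 : min 1 (a / 2) * (‖w t‖ ^ 2 + ‖η t‖ ^ 2) ≤ a / 2 * (‖w t‖ ^ 2 + ‖η t‖ ^ 2) := by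
      gcongr; exact min_le_right _ _
    linarith
  have hup : V (x 0) ^ 2 + U 0
      ≤ (c ^ 2 + 2 * M) * (‖x 0 - e‖ ^ 2 + ‖w 0‖ ^ 2 + ‖η 0‖ ^ 2) := by
    have h1 : V (x 0) ^ 2 ≤ (c * ‖x 0 - e‖) ^ 2 := by
      have := hV0 (x 0)
      gcongr; exact hVup _
    have h2 := hUup 0
    have h3 : 0 ≤ c ^ 2 * (‖w 0‖ ^ 2 + ‖η 0‖ ^ 2) := by positivity
    have h4 : 0 ≤ 2 * M * ‖x 0 - e‖ ^ 2 := by positivity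
    nlinarith
  calc ‖x t - e‖ ^ 2 + ‖w t‖ ^ 2 + ‖η t‖ ^ 2
      ≤ (V (x t) ^ 2 + U t) / min 1 (a / 2) := by rw [le_div_iff₀ hm]; linarith
    _ ≤ ((c ^ 2 + 2 * M) * (‖x 0 - e‖ ^ 2 + ‖w 0‖ ^ 2 + ‖η 0‖ ^ 2)
          * Real.exp (-(2 * r) * t)) / min 1 (a / 2) := by
        gcongr
        exact key.trans (by gcongr)
    _ = _ := by ring

end InterconnectionLyapunov

/-! ### Kronecker products and orthonormal columns -/

section Kronecker

theorem mv_mul {a b c : ℕ} (A : Matrix (Fin a) (Fin b) ℝ) (B : Matrix (Fin b) (Fin c) ℝ)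
    (v : EuclideanSpace ℝ (Fin c)) : mv (A * B) v = mv A (mv B v) := by
  simp [mv]

theorem mv_one {a : ℕ} (v : EuclideanSpace ℝ (Fin a)) :
    mv (1 : Matrix (Fin a) (Fin a) ℝ) v = v := by
  simp [mv]

theorem inner_mv {a b : ℕ} (A : Matrix (Fin a) (Fin b) ℝ) (v : EuclideanSpace ℝ (Fin b))
    (w : EuclideanSpace ℝ (Fin a)) : inner ℝ (mv A v) w = inner ℝ v (mv Aᵀ w) := by
  have := Matrix.toEuclideanLin_conjTranspose_eq_adjoint A
  rw [conjTranspose_eq_transpose_of_trivial] at this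
  rw [mv, mv, this, LinearMap.adjoint_inner_right]

theorem mv_apply {a b : ℕ} (A : Matrix (Fin a) (Fin b) ℝ) (v : EuclideanSpace ℝ (Fin b))
    (i : Fin a) : mv A v i = ∑ j, A i j * v j := rfl

theorem mv_add {a b : ℕ} (A : Matrix (Fin a) (Fin b) ℝ) (v w : EuclideanSpace ℝ (Fin b)) :
    mv A (v + w) = mv A v + mv A w := map_add _ v w

theorem mv_add_left {a b : ℕ} (A B : Matrix (Fin a) (Fin b) ℝ) (v : EuclideanSpace ℝ (Fin b)) :
    mv (A + B) v = mv A v + mv B v := by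
  simp [mv]

theorem mv_zero_left {a b : ℕ} (v : EuclideanSpace ℝ (Fin b)) :
    mv (0 : Matrix (Fin a) (Fin b) ℝ) v = 0 := by
  simp [mv]

theorem kron_apply {a b c d : ℕ} (A : Matrix (Fin a) (Fin b) ℝ) (B : Matrix (Fin c) (Fin d) ℝ)
    (x : Stack b d) (i : Fin a) : kron A B x i = ∑ j, A i j • mv B (x j) := rfl

theorem kron_add {a b c d : ℕ} (A : Matrix (Fin a) (Fin b) ℝ) (B : Matrix (Fin c) (Fin d) ℝ)
    (x y : Stack b d) : kron A B (x + y) = kron A B x + kron A B y := by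
  ext1 i
  simp [kron_apply, smul_add, Finset.sum_add_distrib]

theorem kron_smul {a b c d : ℕ} (A : Matrix (Fin a) (Fin b) ℝ) (B : Matrix (Fin c) (Fin d) ℝ)
    (r : ℝ) (x : Stack b d) : kron A B (r • x) = r • kron A B x := by
  ext1 i
  simp [kron_apply, Finset.smul_sum, smul_comm r]

theorem continuous_kron {a b c d : ℕ} (A : Matrix (Fin a) (Fin b) ℝ)
    (B : Matrix (Fin c) (Fin d) ℝ) : Continuous (kron A B) := by
  have h : Continuous (mv B) := LinearMap.continuous_of_finiteDimensional _
  unfold kron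
  refine (PiLp.continuous_toLp 2 _).comp
    (continuous_pi fun i => continuous_finsetSum _ fun j _ => ?_)
  have hj : Continuous fun x : Stack b d => x j := PiLp.continuous_apply 2 _ j
  exact Continuous.const_smul (h.comp hj) (A i j)

/-- `A ⊗ B` as a continuous linear map. -/
noncomputable def kronL {a b c d : ℕ} (A : Matrix (Fin a) (Fin b) ℝ)
    (B : Matrix (Fin c) (Fin d) ℝ) : Stack b d →L[ℝ] Stack a c where
  toFun := kron A B
  map_add' := kron_add A B
  map_smul' := kron_smul A B
  cont := continuous_kron A B

theorem kronL_apply {a b c d : ℕ} (A : Matrix (Fin a) (Fin b) ℝ) (B : Matrix (Fin c) (Fin d) ℝ)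
    (x : Stack b d) : kronL A B x = kron A B x := rfl

theorem kron_sub {a b c d : ℕ} (A : Matrix (Fin a) (Fin b) ℝ) (B : Matrix (Fin c) (Fin d) ℝ)
    (x y : Stack b d) : kron A B (x - y) = kron A B x - kron A B y :=
  map_sub (kronL A B) x y

theorem kron_zero {a b c d : ℕ} (A : Matrix (Fin a) (Fin b) ℝ) (B : Matrix (Fin c) (Fin d) ℝ) :
    kron A B 0 = 0 :=
  map_zero (kronL A B)

theorem kron_kron {a b c d m k : ℕ} (A : Matrix (Fin a) (Fin b) ℝ) (B : Matrix (Fin c) (Fin d) ℝ)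
    (A' : Matrix (Fin b) (Fin m) ℝ) (B' : Matrix (Fin d) (Fin k) ℝ) (x : Stack m k) :
    kron A B (kron A' B' x) = kron (A * A') (B * B') x := by
  ext1 i
  simp only [kron_apply, map_sum, map_smul, Finset.smul_sum, mv_mul, Matrix.mul_apply,
    Finset.sum_smul, smul_smul]
  exact Finset.sum_comm

theorem kron_one_one {a b : ℕ} (x : Stack a b) : kron 1 1 x = x := by
  ext1 i
  simp [kron_apply, Matrix.one_apply, mv_one]

theorem inner_kron {a b c d : ℕ} (A : Matrix (Fin a) (Fin b) ℝ) (B : Matrix (Fin c) (Fin d) ℝ)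
    (x : Stack b d) (y : Stack a c) : inner ℝ (kron A B x) y = inner ℝ x (kron Aᵀ Bᵀ y) := by
  simp only [PiLp.inner_apply (𝕜 := ℝ) (x := kron A B x), PiLp.inner_apply (𝕜 := ℝ) (x := x),
    kron_apply, sum_inner, inner_sum, inner_smul_left, inner_smul_right, inner_mv,
    Matrix.transpose_apply, RCLike.conj_to_real]
  exact Finset.sum_comm

theorem exists_mul_norm_sq_le_kron {a b : ℕ} {A : Matrix (Fin a) (Fin a) ℝ}
    {B : Matrix (Fin b) (Fin b) ℝ} (hA : IsUnit A) (hB : IsUnit B) :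
    ∃ c : ℝ, 0 < c ∧ ∀ x : Stack a b, c * ‖x‖ ^ 2 ≤ ‖kron A B x‖ ^ 2 := by
  have hA' := Matrix.nonsing_inv_mul A ((Matrix.isUnit_iff_isUnit_det A).1 hA)
  have hB' := Matrix.nonsing_inv_mul B ((Matrix.isUnit_iff_isUnit_det B).1 hB)
  refine ⟨1 / (‖kronL A⁻¹ B⁻¹‖ + 1) ^ 2, by positivity, fun x => ?_⟩
  have h1 := (kronL A⁻¹ B⁻¹).le_opNorm (kron A B x)
  rw [kronL_apply, kron_kron, hA', hB', kron_one_one] at h1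
  rw [one_div_mul_eq_div, div_le_iff₀ (by positivity), ← mul_pow, mul_comm ‖kron A B x‖]
  refine pow_le_pow_left₀ (norm_nonneg x) (h1.trans ?_) 2
  gcongr
  linarith

open scoped MatrixOrder in
/-- A positive definite matrix is `Dᵀ D` with `D` invertible. -/
theorem Matrix.PosDef.exists_eq_transpose_mul_self {a : ℕ} {A : Matrix (Fin a) (Fin a) ℝ}
    (hA : A.PosDef) : ∃ D : Matrix (Fin a) (Fin a) ℝ, IsUnit D ∧ A = Dᵀ * D := by
  obtain ⟨D, hD⟩ := CStarAlgebra.nonneg_iff_eq_star_mul_self.1 hA.posSemidef.nonneg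
  rw [star_eq_conjTranspose, conjTranspose_eq_transpose_of_trivial] at hD
  refine ⟨D, ?_, hD⟩
  have := hA.isUnit
  rw [hD] at this
  exact isUnit_of_mul_isUnit_right this

theorem exists_mul_norm_sq_le_inner_kron {a b : ℕ} {A : Matrix (Fin a) (Fin a) ℝ}
    {B : Matrix (Fin b) (Fin b) ℝ} (hA : A.PosDef) (hB : B.PosDef) :
    ∃ c : ℝ, 0 < c ∧ ∀ x : Stack a b, c * ‖x‖ ^ 2 ≤ inner ℝ (kron A B x) x := by
  obtain ⟨D, hD, rfl⟩ := hA.exists_eq_transpose_mul_self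
  obtain ⟨G, hG, rfl⟩ := hB.exists_eq_transpose_mul_self
  obtain ⟨c, hc, h⟩ := exists_mul_norm_sq_le_kron hD hG
  refine ⟨c, hc, fun x => ?_⟩
  rw [← kron_kron, inner_kron, transpose_transpose, transpose_transpose,
    real_inner_self_eq_norm_sq]
  exact h x

theorem posDef_transpose_mul_self {a : ℕ} {A : Matrix (Fin a) (Fin a) ℝ} (hA : IsUnit A) :
    (Aᵀ * A).PosDef := by
  rw [← conjTranspose_eq_transpose_of_trivial]
  exact Matrix.PosDef.conjTranspose_mul_self A (mulVec_injective_of_isUnit hA)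

end Kronecker

section OrthonormalColumns

variable {a b : ℕ} {A : Matrix (Fin a) (Fin b) ℝ} {S : Submodule ℝ (EuclideanSpace ℝ (Fin a))}

theorem mv_eq_sum_col (A : Matrix (Fin a) (Fin b) ℝ) (u : EuclideanSpace ℝ (Fin b)) :
    mv A u = ∑ j, u j • (WithLp.toLp 2 (A.col j) : EuclideanSpace ℝ (Fin a)) := by
  ext i
  simp [mv_apply, mul_comm]

theorem ColumnsONB.transpose_mul_self (h : ColumnsONB A S) : Aᵀ * A = 1 := by
  ext i j
  have := (orthonormal_iff_ite.1 h.1) i j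
  rw [Matrix.one_apply, ← this, EuclideanSpace.inner_eq_star_dotProduct]
  simp [Matrix.mul_apply, dotProduct, mul_comm]

theorem ColumnsONB.mv_mem (h : ColumnsONB A S) (u : EuclideanSpace ℝ (Fin b)) : mv A u ∈ S := by
  rw [mv_eq_sum_col, ← h.2]
  exact Submodule.sum_mem _ fun j _ => Submodule.smul_mem _ _ (Submodule.subset_span ⟨j, rfl⟩)

theorem ColumnsONB.mv_mv_transpose (h : ColumnsONB A S) {v : EuclideanSpace ℝ (Fin a)}
    (hv : v ∈ S) : mv A (mv Aᵀ v) = v := by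
  rw [← h.2, Submodule.mem_span_range_iff_exists_fun] at hv
  obtain ⟨c, rfl⟩ := hv
  rw [← mv_eq_sum_col A (WithLp.toLp 2 c), ← mv_mul Aᵀ, h.transpose_mul_self, mv_one]

theorem ColumnsONB.mv_transpose_eq_zero (h : ColumnsONB A S) {v : EuclideanSpace ℝ (Fin a)}
    (hv : v ∈ Sᗮ) : mv Aᵀ v = 0 := by
  refine ext_inner_left ℝ fun u => ?_
  rw [← inner_mv, inner_zero_right]
  exact hv _ (h.mv_mem u)

theorem eq_of_mv_eq {A B : Matrix (Fin a) (Fin b) ℝ} (h : ∀ v, mv A v = mv B v) : A = B :=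
  Matrix.toEuclideanLin.injective (LinearMap.ext h)

theorem ColumnsONB.mul_transpose_add {c : ℕ} {B : Matrix (Fin a) (Fin c) ℝ}
    (hA : ColumnsONB A S) (hB : ColumnsONB B Sᗮ) : A * Aᵀ + B * Bᵀ = 1 := by
  refine eq_of_mv_eq fun v => ?_
  obtain ⟨y, hy, z, hz, rfl⟩ := S.exists_add_mem_mem_orthogonal v
  have hy' : y ∈ Sᗮᗮ := S.le_orthogonal_orthogonal hy
  rw [mv_add_left, mv_one, mv_mul, mv_mul, mv_add Aᵀ, mv_add Bᵀ, hA.mv_transpose_eq_zero hz,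
    hB.mv_transpose_eq_zero hy', add_zero, zero_add, hA.mv_mv_transpose hy, hB.mv_mv_transpose hz]

end OrthonormalColumns

/-! ### Matrix identities of the coordinate change -/

namespace MultiAgent

variable {N n q : ℕ} (S : MultiAgent N n q)

/-- The matrix identities behind the coordinate change: `[Z W]` is orthogonal with `E Z = 0` and
`E W` invertible, the columns of `R` are orthonormal and sum to zero, and they span the orthogonal
complement of `1_N`. -/
structure IsAdapted : Prop where
  add_mul_transpose : S.Z * S.Zᵀ + S.W * S.Wᵀ = 1
  mul_Z : S.E * S.Z = 0
  isUnit : IsUnit (S.E * S.W)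
  transpose_mul_R : S.Rᵀ * S.R = 1
  sum_R : ∀ k, ∑ i, S.R i k = 0
  R_mul_transpose : ∀ i j, (S.R * S.Rᵀ) i j = (1 : Matrix (Fin N) (Fin N) ℝ) i j - 1 / N

variable {S}

theorem isAdapted_of_columnsONB (hN : 0 < N) (h_rank : S.E.rank = q)
    (h_Z : ColumnsONB S.Z (LinearMap.ker (Matrix.toEuclideanLin S.E)))
    (h_W : ColumnsONB S.W (LinearMap.ker (Matrix.toEuclideanLin S.E))ᗮ)
    (h_R : ColumnsONB S.R
      (LinearMap.ker (Matrix.toEuclideanLin (Matrix.of fun (_ : Fin 1) (_ : Fin N) => (1 : ℝ))))) :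
    S.IsAdapted := by
  have hEZ : S.E * S.Z = 0 := eq_of_mv_eq fun v => by
    rw [mv_mul, mv_zero_left]
    exact h_Z.mv_mem v
  have hZW := h_Z.mul_transpose_add h_W
  have hmem : ∀ v : EuclideanSpace ℝ (Fin N), v ∈ LinearMap.ker (Matrix.toEuclideanLin
      (Matrix.of fun (_ : Fin 1) (_ : Fin N) => (1 : ℝ))) ↔ ∑ i, v i = 0 := by
    intro v
    rw [LinearMap.mem_ker]
    constructor
    · intro h
      have := congrArg (fun u : EuclideanSpace ℝ (Fin 1) => u 0) h
      simpa [Matrix.mulVec, dotProduct] using this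
    · intro h
      ext i
      simpa [Matrix.mulVec, dotProduct] using h
  have hsum : ∀ k, ∑ i, S.R i k = 0 := by
    intro k
    have h1 := (hmem _).1 (h_R.mv_mem (EuclideanSpace.single k 1))
    simpa [mv_apply] using h1
  refine ⟨hZW, hEZ, ?_, h_R.transpose_mul_self, hsum, fun i j => ?_⟩
  · have hE : S.E = S.E * S.W * S.Wᵀ := by
      calc S.E = S.E * (S.Z * S.Zᵀ + S.W * S.Wᵀ) := by rw [hZW, Matrix.mul_one]
        _ = _ := by rw [Matrix.mul_add, ← Matrix.mul_assoc, hEZ, Matrix.zero_mul, zero_add,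
            Matrix.mul_assoc]
    have h1 : q ≤ (S.E * S.W).rank := by
      calc q = (S.E * S.W * S.Wᵀ).rank := by rw [← hE, h_rank]
        _ ≤ _ := Matrix.rank_mul_le_left _ _
    have h2 : LinearIndependent ℝ (S.E * S.W).col := by
      rw [linearIndependent_iff_card_le_finrank_span, Fintype.card_fin]
      rwa [Matrix.rank_eq_finrank_span_cols] at h1
    exact Matrix.linearIndependent_cols_iff_isUnit.1 h2
  · have hN' : (N : ℝ) ≠ 0 := by exact_mod_cast hN.ne'
    -- the projection of the `j`-th basis vector
    let b : EuclideanSpace ℝ (Fin N) := WithLp.toLp 2 (fun _ => 1 / (N : ℝ))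
    let v : EuclideanSpace ℝ (Fin N) := EuclideanSpace.single j 1
    have hv : v - b ∈ LinearMap.ker (Matrix.toEuclideanLin
        (Matrix.of fun (_ : Fin 1) (_ : Fin N) => (1 : ℝ))) := by
      rw [hmem]
      simp [v, b, hN']
    have hb : mv S.Rᵀ b = 0 := by
      ext k
      rw [mv_apply]
      simp only [b, Matrix.transpose_apply, ← Finset.sum_mul, hsum, zero_mul]
      rfl
    have h1 := h_R.mv_mv_transpose hv
    rw [show mv S.Rᵀ (v - b) = mv S.Rᵀ v - mv S.Rᵀ b from map_sub _ _ _, hb, sub_zero,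
      ← mv_mul] at h1
    have h2 := congrArg (fun u : EuclideanSpace ℝ (Fin N) => u i) h1
    simpa [mv_apply, v, b, Matrix.one_apply, Pi.single_apply] using h2

theorem lap_transpose : S.lapᵀ = S.lap := by
  classical
  exact SimpleGraph.isSymm_lapMatrix (R := ℝ) S.graph

theorem sum_lap_row (i : Fin N) : ∑ j, S.lap i j = 0 := by
  classical
  have := congrFun (SimpleGraph.lapMatrix_mulVec_const_eq_zero (R := ℝ) S.graph) i
  simpa [Matrix.mulVec, dotProduct, lap] using this

theorem sum_lap_col (j : Fin N) : ∑ i, S.lap i j = 0 := by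
  rw [← sum_lap_row (S := S) j]
  refine Finset.sum_congr rfl fun i _ => ?_
  conv_lhs => rw [← lap_transpose, Matrix.transpose_apply]

theorem IsAdapted.lamP_mul (h : S.IsAdapted) : S.lamP * S.Rᵀ = S.Rᵀ * S.lap := by
  have h1 : S.lap * (S.R * S.Rᵀ) = S.lap := by
    ext i j
    simp only [Matrix.mul_apply (M := S.lap), h.R_mul_transpose, mul_sub, Finset.sum_sub_distrib,
      ← Finset.sum_mul, sum_lap_row, zero_mul, sub_zero, Matrix.one_apply]
    simp
  rw [lamP, Matrix.mul_assoc, Matrix.mul_assoc, h1]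

theorem IsAdapted.lamP_posDef (h : S.IsAdapted) (h_conn : S.graph.Connected) :
    S.lamP.PosDef := by
  classical
  have hps : S.lap.PosSemidef := SimpleGraph.posSemidef_lapMatrix ℝ S.graph
  have hps' : S.lamP.PosSemidef := by
    have := hps.conjTranspose_mul_mul_same S.R
    rwa [conjTranspose_eq_transpose_of_trivial] at this
  refine Matrix.PosDef.of_dotProduct_mulVec_pos hps'.1 fun x hx => ?_
  refine lt_of_le_of_ne (hps'.dotProduct_mulVec_nonneg x) fun h0 => hx ?_
  have h1 : star (S.R *ᵥ x) ⬝ᵥ (S.lap *ᵥ (S.R *ᵥ x)) = 0 := by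
    rw [h0, lamP]
    simp [Matrix.dotProduct_mulVec, Matrix.vecMul_mulVec, ← Matrix.mulVec_mulVec,
      Matrix.vecMul_transpose]
  rw [hps.dotProduct_mulVec_zero_iff] at h1
  have h2 := (SimpleGraph.lapMatrix_mulVec_eq_zero_iff_forall_reachable S.graph).1 h1
  have hsum : ∑ i, (S.R *ᵥ x) i = 0 := by
    simp only [Matrix.mulVec, dotProduct]
    rw [Finset.sum_comm]
    simp [← Finset.sum_mul, h.sum_R]
  have h3 : S.R *ᵥ x = 0 := by
    ext i
    have h4 : ∀ j, (S.R *ᵥ x) j = (S.R *ᵥ x) i := fun j => h2 j i (h_conn.preconnected j i)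
    simp only [h4, Finset.sum_const, Finset.card_univ, Fintype.card_fin, nsmul_eq_mul] at hsum
    have hN : (N : ℝ) ≠ 0 := by
      have := i.pos
      positivity
    exact (mul_eq_zero.1 hsum).resolve_left hN
  calc x = (S.Rᵀ * S.R) *ᵥ x := by rw [h.transpose_mul_R, Matrix.one_mulVec]
    _ = 0 := by rw [← Matrix.mulVec_mulVec, h3, Matrix.mulVec_zero]

theorem IsAdapted.lamI_posDef (h : S.IsAdapted) (h_conn : S.graph.Connected) (C : Coupling) :
    (S.lamI C).PosDef := by
  cases C
  · exact h.lamP_posDef h_conn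
  · exact Matrix.PosDef.one

theorem IsAdapted.E_eq (h : S.IsAdapted) : S.E * S.W * S.Wᵀ = S.E := by
  calc S.E * S.W * S.Wᵀ = S.E * S.Z * S.Zᵀ + S.E * S.W * S.Wᵀ := by
        rw [h.mul_Z, Matrix.zero_mul, zero_add]
    _ = S.E * (S.Z * S.Zᵀ + S.W * S.Wᵀ) := by
        rw [Matrix.mul_add, Matrix.mul_assoc, Matrix.mul_assoc]
    _ = S.E := by rw [h.add_mul_transpose, Matrix.mul_one]

theorem IsAdapted.isUnit_transpose (h : S.IsAdapted) : IsUnit (S.Wᵀ * S.Eᵀ) := by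
  rw [← Matrix.transpose_mul]
  exact (Matrix.isUnit_transpose _).2 h.isUnit

end MultiAgent

/-! ### The error field as an interconnection -/

section ProductDerivatives

variable {α β : Type*} [NormedAddCommGroup α] [NormedSpace ℝ α] [NormedAddCommGroup β]
  [NormedSpace ℝ β]

theorem HasDerivWithinAt.toLp_prodMk {f : ℝ → α} {g : ℝ → β} {f' : α} {g' : β} {A : Set ℝ} {t : ℝ}
    (hf : HasDerivWithinAt f f' A t) (hg : HasDerivWithinAt g g' A t) :
    HasDerivWithinAt (fun s => WithLp.toLp 2 (f s, g s)) (WithLp.toLp 2 (f', g')) A t :=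
  (WithLp.prodContinuousLinearEquiv 2 ℝ α β).symm.hasFDerivAt.comp_hasDerivWithinAt t
    (hf.prodMk hg)

theorem HasDerivWithinAt.withLp_fst {f : ℝ → WithLp 2 (α × β)} {f' : WithLp 2 (α × β)} {A : Set ℝ}
    {t : ℝ} (hf : HasDerivWithinAt f f' A t) :
    HasDerivWithinAt (fun s => (f s).fst) f'.fst A t :=
  (WithLp.fstL 2 ℝ α β).hasFDerivAt.comp_hasDerivWithinAt t hf

theorem HasDerivWithinAt.withLp_snd {f : ℝ → WithLp 2 (α × β)} {f' : WithLp 2 (α × β)} {A : Set ℝ}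
    {t : ℝ} (hf : HasDerivWithinAt f f' A t) :
    HasDerivWithinAt (fun s => (f s).snd) f'.snd A t :=
  (WithLp.sndL 2 ℝ α β).hasFDerivAt.comp_hasDerivWithinAt t hf

theorem hasDerivWithinAt_piLp_two {ι : Type*} [Fintype ι] {f : ℝ → PiLp 2 fun _ : ι => α}
    {f' : PiLp 2 fun _ : ι => α} {A : Set ℝ} {t : ℝ}
    (hf : ∀ i, HasDerivWithinAt (fun s => f s i) (f' i) A t) : HasDerivWithinAt f f' A t := by
  rw [hasDerivWithinAt_iff_hasFDerivWithinAt, hasFDerivWithinAt_piLp]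
  exact fun i => (hf i).hasFDerivWithinAt.congr_fderiv (by ext; simp)

end ProductDerivatives

theorem continuous_mv {a b : ℕ} (A : Matrix (Fin a) (Fin b) ℝ) : Continuous (mv A) :=
  LinearMap.continuous_of_finiteDimensional _

theorem norm_stack_apply_le {a b : ℕ} (x : Stack a b) (i : Fin a) : ‖x i‖ ≤ ‖x‖ :=
  PiLp.norm_apply_le x i

namespace MultiAgent

variable {N n q : ℕ} (S : MultiAgent N n q)

/-- `[I_N ⊗ Zᵀ; (1/N) 1_Nᵀ ⊗ Wᵀ]`, which sends a stacked agent state to a blended state. -/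
noncomputable def toBlended : Stack N n →L[ℝ] BlendedState N n q where
  toFun y := WithLp.toLp 2 (WithLp.toLp 2 (fun i => mv S.Zᵀ (y i)),
    (1 / (N : ℝ)) • ∑ i, mv S.Wᵀ (y i))
  map_add' x y := by
    refine WithLp.ofLp_injective 2 (Prod.ext ?_ ?_)
    · ext1 i
      exact mv_add _ _ _
    · simp [Finset.sum_add_distrib]
  map_smul' c y := by
    refine WithLp.ofLp_injective 2 (Prod.ext ?_ ?_)
    · ext1 i
      exact map_smul (Matrix.toEuclideanLin S.Zᵀ) c (y i)
    · simp [← Finset.smul_sum, smul_comm c]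
  cont := by
    have hj : ∀ i, Continuous fun x : Stack N n => x i := fun i => PiLp.continuous_apply 2 _ i
    refine (WithLp.prod_continuous_toLp 2 _ _).comp (Continuous.prodMk
      ((PiLp.continuous_toLp 2 _).comp (continuous_pi fun i => (continuous_mv _).comp (hj i)))
      (Continuous.const_smul
        (continuous_finsetSum _ fun i _ => (continuous_mv S.Wᵀ).comp (hj i)) (1 / (N : ℝ))))

/-- `[I_N ⊗ Z, 1_N ⊗ W]`, the linear map underlying `xStar`. -/
noncomputable def ofBlended : BlendedState N n q →L[ℝ] Stack N n where
  toFun := S.xStar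
  map_add' x y := by
    ext1 i
    simp only [xStar, WithLp.add_fst, WithLp.add_snd, PiLp.add_apply, mv_add]
    abel
  map_smul' c y := by
    ext1 i
    simp [xStar]
  cont := by
    have h1 : ∀ i, Continuous fun e : BlendedState N n q => e.fst i := fun i =>
      (PiLp.continuous_apply 2 (fun _ : Fin N => EuclideanSpace ℝ (Fin (n - q))) i).comp
        (WithLp.fstL 2 ℝ (Stack N (n - q)) (EuclideanSpace ℝ (Fin q))).continuous
    have h2 : Continuous fun e : BlendedState N n q => e.snd :=
      (WithLp.sndL 2 ℝ (Stack N (n - q)) (EuclideanSpace ℝ (Fin q))).continuous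
    exact (PiLp.continuous_toLp 2 _).comp (continuous_pi fun i =>
      ((continuous_mv S.Z).comp (h1 i)).add ((continuous_mv S.W).comp h2))

theorem xStar_sub (e e' : BlendedState N n q) : S.xStar (e - e') = S.xStar e - S.xStar e' :=
  map_sub S.ofBlended e e'

theorem blended_eq (e : BlendedState N n q) : S.blended e = S.toBlended (S.hStack (S.xStar e)) :=
  rfl

theorem errorField_fst (C : Coupling) (κ kP kI : ℝ) (es : BlendedState N n q)
    (v : ErrorState N n q) :
    (S.errorField C κ kP kI es v).fst = S.toBlended (S.hStack (S.xOf es v)) :=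
  rfl

theorem errorField_snd_fst (C : Coupling) (κ kP kI : ℝ) (es : BlendedState N n q)
    (v : ErrorState N n q) : (S.errorField C κ kP kI es v).snd.fst =
      kron S.Rᵀ S.Wᵀ (S.hStack (S.xOf es v) - S.hStack (S.xStar es))
          - kP • kron S.lamP (S.Wᵀ * S.Eᵀ * S.E * S.W) v.snd.fst
          - kI • kron (S.lamI C) (S.Wᵀ * S.Eᵀ) v.snd.snd :=
  rfl

theorem errorField_snd_snd (C : Coupling) (κ kP kI : ℝ) (es : BlendedState N n q)
    (v : ErrorState N n q) : (S.errorField C κ kP kI es v).snd.snd =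
      κ • kron S.lamP (S.K * S.E * S.W) v.snd.fst :=
  rfl

variable {S}

theorem exists_lipschitzWith_hStack (h_lip : ∀ i : Fin N, ∃ L : NNReal, LipschitzWith L (S.h i)) :
    ∃ L : ℝ≥0, LipschitzWith L S.hStack := by
  choose L hL using h_lip
  refine ⟨∑ i, L i, LipschitzWith.of_dist_le_mul fun x y => ?_⟩
  rw [dist_eq_norm, dist_eq_norm]
  refine le_of_sq_le_sq ?_ (by positivity)
  rw [mul_pow, PiLp.norm_sq_eq_of_L2, PiLp.norm_sq_eq_of_L2, Finset.mul_sum]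
  refine Finset.sum_le_sum fun i _ => ?_
  rw [← mul_pow]
  refine pow_le_pow_left₀ (norm_nonneg _) ?_ 2
  have h1 := (hL i).dist_le_mul (x i) (y i)
  rw [dist_eq_norm, dist_eq_norm] at h1
  refine h1.trans ?_
  have h2 : L i ≤ ∑ j, L j := Finset.single_le_sum (fun _ _ => zero_le) (Finset.mem_univ i)
  have h3 : (L i : ℝ) ≤ (∑ j, L j : ℝ≥0) := by exact_mod_cast h2
  exact mul_le_mul_of_nonneg_right h3 (norm_nonneg _)

theorem norm_xOf_sub_le (es : BlendedState N n q) (v : ErrorState N n q) :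
    ‖S.xOf es v - S.xStar es‖ ≤ ‖S.ofBlended‖ * ‖v.fst‖ + ‖kronL S.R S.W‖ * ‖v.snd.fst‖ := by
  have h1 : S.xOf es v - S.xStar es = S.ofBlended v.fst + kronL S.R S.W v.snd.fst := by
    have : S.ofBlended v.fst = S.xStar (v.fst + es) - S.xStar es := by
      rw [← xStar_sub, add_sub_cancel_right]
      rfl
    rw [this, xOf, kronL_apply]
    abel
  rw [h1]
  exact (norm_add_le _ _).trans (add_le_add (S.ofBlended.le_opNorm _) ((kronL S.R S.W).le_opNorm _))

theorem errorField_zero (C : Coupling) (κ kP kI : ℝ) {es : BlendedState N n q}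
    (hes : S.blended es = 0) : S.errorField C κ kP kI es 0 = 0 := by
  have hx : S.xOf es 0 = S.xStar es := by
    have h1 : (0 : ErrorState N n q).fst = 0 := rfl
    have h2 : (0 : ErrorState N n q).snd.fst = 0 := rfl
    rw [xOf, h1, h2, kron_zero, zero_add, add_zero]
  have h3 : (0 : ErrorState N n q).snd.fst = 0 := rfl
  have h4 : (0 : ErrorState N n q).snd.snd = 0 := rfl
  refine WithLp.ofLp_injective 2 (Prod.ext ?_ (WithLp.ofLp_injective 2 (Prod.ext ?_ ?_)))
  · change (S.errorField C κ kP kI es 0).fst = 0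
    rw [errorField_fst, hx, ← blended_eq, hes]
  · change (S.errorField C κ kP kI es 0).snd.fst = 0
    rw [errorField_snd_fst, hx, sub_self, h3, h4, kron_zero, kron_zero, kron_zero]
    simp
  · change (S.errorField C κ kP kI es 0).snd.snd = 0
    rw [errorField_snd_snd, h3, kron_zero, smul_zero]

end MultiAgent

/-! ### Coercivity and coupling bounds -/

namespace MultiAgent

variable {N n q : ℕ} {S : MultiAgent N n q}

theorem gram_eq (S : MultiAgent N n q) :
    S.Wᵀ * S.Eᵀ * S.E * S.W = S.Wᵀ * S.Eᵀ * (S.Wᵀ * S.Eᵀ)ᵀ := by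
  rw [Matrix.transpose_mul, transpose_transpose, transpose_transpose]
  simp only [Matrix.mul_assoc]

theorem gram_transpose (S : MultiAgent N n q) :
    (S.Wᵀ * S.Eᵀ * S.E * S.W)ᵀ = S.Wᵀ * S.Eᵀ * S.E * S.W := by
  rw [gram_eq, Matrix.transpose_mul, transpose_transpose]

theorem IsAdapted.isUnit_gram (h : S.IsAdapted) : IsUnit (S.Wᵀ * S.Eᵀ * S.E * S.W) := by
  rw [Matrix.mul_assoc (S.Wᵀ * S.Eᵀ)]
  exact h.isUnit_transpose.mul h.isUnit

theorem lamP_transpose (S : MultiAgent N n q) : S.lamPᵀ = S.lamP := by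
  rw [lamP, Matrix.transpose_mul, Matrix.transpose_mul, transpose_transpose, lap_transpose,
    Matrix.mul_assoc]

theorem lamI_transpose (S : MultiAgent N n q) (C : Coupling) : (S.lamI C)ᵀ = S.lamI C := by
  cases C
  · exact lamP_transpose S
  · exact transpose_one

theorem IsAdapted.gram_sq_posDef (h : S.IsAdapted) :
    ((S.Wᵀ * S.Eᵀ * S.E * S.W) * (S.Wᵀ * S.Eᵀ * S.E * S.W)).PosDef := by
  have := posDef_transpose_mul_self h.isUnit_gram
  rwa [gram_transpose] at this

theorem IsAdapted.gram_cube_posDef (h : S.IsAdapted) :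
    ((S.Wᵀ * S.Eᵀ * S.E * S.W) *
      ((S.Wᵀ * S.Eᵀ * S.E * S.W) * (S.Wᵀ * S.Eᵀ * S.E * S.W))).PosDef := by
  have h2 := posDef_transpose_mul_self
    (((Matrix.isUnit_transpose _).2 h.isUnit_transpose).mul h.isUnit_gram)
  convert h2 using 1
  rw [Matrix.transpose_mul, transpose_transpose, gram_transpose]
  conv_rhs => rw [Matrix.mul_assoc, ← Matrix.mul_assoc (S.Wᵀ * S.Eᵀ) (S.Wᵀ * S.Eᵀ)ᵀ,
    ← gram_eq]

theorem IsAdapted.lamP_sq_posDef (h : S.IsAdapted) (h_conn : S.graph.Connected) :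
    (S.lamP * S.lamP).PosDef := by
  have := posDef_transpose_mul_self (h.lamP_posDef h_conn).isUnit
  rwa [lamP_transpose] at this

/-- The operators `P = Λ_P ⊗ M`, `J = k_I Λ_I ⊗ I` and `Q = κ Λ_P ⊗ M ^ 2`, with
`M = Wᵀ Eᵀ E W`, satisfy the positivity conditions of the abstract decay estimate. -/
theorem IsAdapted.exists_coercive (h : S.IsAdapted) (h_conn : S.graph.Connected) (C : Coupling)
    {κ kI : ℝ} (hκ : 0 < κ) (hkI : 0 < kI) {M : Matrix (Fin q) (Fin q) ℝ}
    (hM : M = S.Wᵀ * S.Eᵀ * S.E * S.W) :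
    ∃ a : ℝ, 0 < a ∧ ∀ x : Stack (N - 1) q,
      a * ‖x‖ ^ 2 ≤ inner ℝ ((kI • kronL (S.lamI C) 1) x) x ∧
      a * ‖x‖ ^ 2 ≤ inner ℝ ((κ • kronL S.lamP (M * M)) x) x ∧
      a * ‖x‖ ^ 2 ≤ inner ℝ ((κ • kronL S.lamP (M * M)) x) (kronL S.lamP M x) := by
  obtain ⟨a₁, ha₁, hJ⟩ := exists_mul_norm_sq_le_inner_kron (h.lamI_posDef h_conn C)
    (Matrix.PosDef.one : (1 : Matrix (Fin q) (Fin q) ℝ).PosDef)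
  obtain ⟨a₂, ha₂, hQ⟩ := exists_mul_norm_sq_le_inner_kron (h.lamP_posDef h_conn) h.gram_sq_posDef
  obtain ⟨a₃, ha₃, hQP⟩ :=
    exists_mul_norm_sq_le_inner_kron (h.lamP_sq_posDef h_conn) h.gram_cube_posDef
  rw [← hM] at hQ hQP
  have hMt : Mᵀ = M := by rw [hM, gram_transpose]
  refine ⟨min (kI * a₁) (min (κ * a₂) (κ * a₃)), by positivity, fun x => ?_⟩
  have e1 : inner ℝ ((kI • kronL (S.lamI C) 1) x) x = kI * inner ℝ (kron (S.lamI C) 1 x) x :=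
    real_inner_smul_left _ _ _
  have e2 : inner ℝ ((κ • kronL S.lamP (M * M)) x) x = κ * inner ℝ (kron S.lamP (M * M) x) x :=
    real_inner_smul_left _ _ _
  have e3 : inner ℝ ((κ • kronL S.lamP (M * M)) x) (kronL S.lamP M x)
      = κ * inner ℝ (kron (S.lamP * S.lamP) (M * (M * M)) x) x := by
    refine (real_inner_smul_left _ _ _).trans ?_
    change κ * inner ℝ (kron S.lamP (M * M) x) (kron S.lamP M x) = _
    rw [real_inner_comm, inner_kron, kron_kron, lamP_transpose, hMt,
      real_inner_comm]
  have h0 : 0 ≤ ‖x‖ ^ 2 := by positivity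
  rw [e1, e2, e3]
  refine ⟨?_, ?_, ?_⟩
  · have h1 := mul_le_mul_of_nonneg_left (hJ x) hkI.le
    have h2 := mul_le_mul_of_nonneg_right (min_le_left (kI * a₁) (min (κ * a₂) (κ * a₃))) h0
    linarith
  · have h1 := mul_le_mul_of_nonneg_left (hQ x) hκ.le
    have h2 := mul_le_mul_of_nonneg_right ((min_le_right (kI * a₁) (min (κ * a₂) (κ * a₃))).trans
      (min_le_left _ _)) h0
    linarith
  · have h1 := mul_le_mul_of_nonneg_left (hQP x) hκ.le
    have h2 := mul_le_mul_of_nonneg_right ((min_le_right (kI * a₁) (min (κ * a₂) (κ * a₃))).trans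
      (min_le_right _ _)) h0
    linarith

theorem inner_smul_kronL_comm {a b : ℕ} {A : Matrix (Fin a) (Fin a) ℝ}
    {B : Matrix (Fin b) (Fin b) ℝ} (hA : Aᵀ = A) (hB : Bᵀ = B) (r : ℝ) (x y : Stack a b) :
    inner ℝ ((r • kronL A B) x) y = inner ℝ x ((r • kronL A B) y) := by
  refine (real_inner_smul_left _ _ _).trans (Eq.trans ?_ (real_inner_smul_right _ _ _).symm)
  change r * inner ℝ (kron A B x) y = r * inner ℝ x (kron A B y)
  rw [inner_kron, hA, hB]

/-- The couplings between the blended part and the disagreement part are Lipschitz. -/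
theorem exists_coupling_bound (h_lip : ∀ i : Fin N, ∃ L : NNReal, LipschitzWith L (S.h i))
    (es : BlendedState N n q) :
    ∃ B : ℝ, 0 ≤ B ∧ ∀ v : ErrorState N n q,
      ‖S.toBlended (S.hStack (S.xOf es v)) - S.blended (v.fst + es)‖ ≤ B * ‖v.snd.fst‖ ∧
      ‖kron S.Rᵀ S.Wᵀ (S.hStack (S.xOf es v) - S.hStack (S.xStar es))‖
        ≤ B * (‖v.fst‖ + ‖v.snd.fst‖) := by
  obtain ⟨Lh, hLh⟩ := exists_lipschitzWith_hStack h_lip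
  have hhs : ∀ x y : Stack N n, ‖S.hStack x - S.hStack y‖ ≤ Lh * ‖x - y‖ := fun x y => by
    simpa only [dist_eq_norm] using hLh.dist_le_mul x y
  have p0 : 0 ≤ ‖kronL S.Rᵀ S.Wᵀ‖ := norm_nonneg _
  have p1 : 0 ≤ ‖kronL S.R S.W‖ := norm_nonneg _
  have p2 : 0 ≤ ‖S.ofBlended‖ := norm_nonneg _
  have p3 : 0 ≤ ‖S.toBlended‖ := norm_nonneg _
  have hL0 : (0 : ℝ) ≤ Lh := Lh.2
  refine ⟨(‖S.toBlended‖ + ‖kronL S.Rᵀ S.Wᵀ‖) * (Lh * (‖S.ofBlended‖ + ‖kronL S.R S.W‖)),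
    by positivity, fun v => ⟨?_, ?_⟩⟩
  · have h1 : S.xOf es v - S.xStar (v.fst + es) = kronL S.R S.W v.snd.fst :=
      add_sub_cancel_left _ _
    have h2 := hhs (S.xOf es v) (S.xStar (v.fst + es))
    rw [h1] at h2
    have h3 := (kronL S.R S.W).le_opNorm v.snd.fst
    have h4 := S.toBlended.le_opNorm (S.hStack (S.xOf es v) - S.hStack (S.xStar (v.fst + es)))
    rw [blended_eq, ← map_sub]
    have p4 : 0 ≤ ‖v.snd.fst‖ := norm_nonneg _
    calc _ ≤ ‖S.toBlended‖ * (Lh * (‖kronL S.R S.W‖ * ‖v.snd.fst‖)) :=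
          h4.trans (mul_le_mul_of_nonneg_left
            (h2.trans (mul_le_mul_of_nonneg_left h3 hL0)) p3)
      _ ≤ (‖S.toBlended‖ + ‖kronL S.Rᵀ S.Wᵀ‖) *
          (Lh * ((‖S.ofBlended‖ + ‖kronL S.R S.W‖) * ‖v.snd.fst‖)) := by
        gcongr <;> linarith
      _ = _ := by ring
  · have h2 := (hhs (S.xOf es v) (S.xStar es)).trans
      (mul_le_mul_of_nonneg_left (norm_xOf_sub_le es v) hL0)
    have h4 := (kronL S.Rᵀ S.Wᵀ).le_opNorm (S.hStack (S.xOf es v) - S.hStack (S.xStar es))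
    have p4 : 0 ≤ ‖v.snd.fst‖ := norm_nonneg _
    have p5 : 0 ≤ ‖v.fst‖ := norm_nonneg _
    rw [kronL_apply] at h4
    calc _ ≤ ‖kronL S.Rᵀ S.Wᵀ‖ *
          (Lh * (‖S.ofBlended‖ * ‖v.fst‖ + ‖kronL S.R S.W‖ * ‖v.snd.fst‖)) :=
          h4.trans (mul_le_mul_of_nonneg_left h2 p0)
      _ ≤ (‖S.toBlended‖ + ‖kronL S.Rᵀ S.Wᵀ‖) *
          (Lh * ((‖S.ofBlended‖ + ‖kronL S.R S.W‖) * (‖v.fst‖ + ‖v.snd.fst‖))) := by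
        have h5 : ‖S.ofBlended‖ * ‖v.fst‖ + ‖kronL S.R S.W‖ * ‖v.snd.fst‖
            ≤ (‖S.ofBlended‖ + ‖kronL S.R S.W‖) * (‖v.fst‖ + ‖v.snd.fst‖) := by
          nlinarith [mul_nonneg p2 p4, mul_nonneg p1 p5]
        gcongr
        linarith
      _ = _ := by ring

theorem norm_errorState_sq (v : ErrorState N n q) :
    ‖v‖ ^ 2 = ‖v.fst‖ ^ 2 + ‖v.snd.fst‖ ^ 2 + ‖v.snd.snd‖ ^ 2 := by
  rw [WithLp.prod_norm_sq_eq_of_L2, WithLp.prod_norm_sq_eq_of_L2 v.snd]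
  ring

/-- Replacing `ξ̃_δ` by `(I ⊗ F) ξ̃_δ` with `F` invertible gives an equivalent norm. -/
theorem exists_norm_equiv {F : Matrix (Fin q) (Fin q) ℝ} (hF : IsUnit F) (N n : ℕ) :
    ∃ b : ℝ, 0 < b ∧ ∀ v : ErrorState N n q,
      ‖v‖ ^ 2 ≤ b * (‖v.fst‖ ^ 2 + ‖v.snd.fst‖ ^ 2 +
          ‖kronL (1 : Matrix (Fin (N - 1)) (Fin (N - 1)) ℝ) F v.snd.snd‖ ^ 2) ∧
      ‖v.fst‖ ^ 2 + ‖v.snd.fst‖ ^ 2 +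
          ‖kronL (1 : Matrix (Fin (N - 1)) (Fin (N - 1)) ℝ) F v.snd.snd‖ ^ 2 ≤ b * ‖v‖ ^ 2 := by
  obtain ⟨b, hb, hbF⟩ := exists_mul_norm_sq_le_kron
    (isUnit_one : IsUnit (1 : Matrix (Fin (N - 1)) (Fin (N - 1)) ℝ)) hF
  set g : ℝ := ‖kronL (1 : Matrix (Fin (N - 1)) (Fin (N - 1)) ℝ) F‖ with hg
  refine ⟨1 + 1 / b + g ^ 2, by positivity, fun v => ?_⟩
  rw [norm_errorState_sq]
  have h1 := hbF v.snd.snd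
  rw [← kronL_apply] at h1
  have h5 : ‖kronL (1 : Matrix (Fin (N - 1)) (Fin (N - 1)) ℝ) F v.snd.snd‖ ^ 2 ≤ (g * ‖v.snd.snd‖) ^ 2 :=
    pow_le_pow_left₀ (norm_nonneg _) ((kronL (1 : Matrix (Fin (N - 1)) (Fin (N - 1)) ℝ) F).le_opNorm _) 2
  rw [mul_pow] at h5
  generalize ‖kronL (1 : Matrix (Fin (N - 1)) (Fin (N - 1)) ℝ) F v.snd.snd‖ ^ 2 = y at *
  have h0 : 0 ≤ ‖v.snd.snd‖ ^ 2 := by positivity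
  have h6 : 0 ≤ ‖v.fst‖ ^ 2 + ‖v.snd.fst‖ ^ 2 := by positivity
  generalize ‖v.snd.snd‖ ^ 2 = z at *
  generalize ‖v.fst‖ ^ 2 + ‖v.snd.fst‖ ^ 2 = u at *
  have hy : 0 ≤ y := by nlinarith
  have h2 : z ≤ 1 / b * y := by
    rw [one_div_mul_eq_div, le_div_iff₀ hb, mul_comm]; exact h1
  have hb' : 0 ≤ 1 / b := by positivity
  have hg' := sq_nonneg g
  have q1 := mul_nonneg hb' h6
  have q2 := mul_nonneg hg' h6
  have q3 := mul_nonneg hg' hy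
  have q4 := mul_nonneg hb' h0
  exact ⟨by linarith, by linarith⟩

end MultiAgent

/-! ### Decay of the error system -/

namespace MultiAgent

variable {N n q : ℕ} {S : MultiAgent N n q}

theorem exists_lipschitzWith_blended
    (h_lip : ∀ i : Fin N, ∃ L : NNReal, LipschitzWith L (S.h i)) :
    ∃ L : ℝ≥0, LipschitzWith L S.blended := by
  obtain ⟨L, hL⟩ := exists_lipschitzWith_hStack h_lip
  obtain ⟨c, hc⟩ : ∃ c : ℝ, c = ‖S.toBlended‖ * (L * ‖S.ofBlended‖) := ⟨_, rfl⟩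
  have hc0 : 0 ≤ c := by rw [hc]; positivity
  refine ⟨c.toNNReal, LipschitzWith.of_dist_le_mul fun x y => ?_⟩
  rw [dist_eq_norm, dist_eq_norm, Real.coe_toNNReal c hc0, hc, blended_eq, blended_eq, ← map_sub]
  have h1 := S.toBlended.le_opNorm (S.hStack (S.xStar x) - S.hStack (S.xStar y))
  have h2 := hL.dist_le_mul (S.xStar x) (S.xStar y)
  have h3 : ‖S.xStar x - S.xStar y‖ ≤ ‖S.ofBlended‖ * ‖x - y‖ := by
    rw [← xStar_sub]
    exact S.ofBlended.le_opNorm (x - y)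
  rw [dist_eq_norm, dist_eq_norm] at h2
  calc _ ≤ ‖S.toBlended‖ * (L * (‖S.ofBlended‖ * ‖x - y‖)) :=
        h1.trans (mul_le_mul_of_nonneg_left
          (h2.trans (mul_le_mul_of_nonneg_left h3 L.2)) (norm_nonneg _))
    _ = _ := by ring

/-- The error dynamics as an interconnection: in the coordinates `e + e*`, `w̃` and
`η = (I ⊗ Wᵀ Eᵀ) ξ̃_δ` all operators of the linear part are Kronecker products of positive definite
matrices, so that the abstract decay estimate applies for every ratio of the gains. -/
theorem IsAdapted.exists_gain_errorField_decay (h : S.IsAdapted) (h_conn : S.graph.Connected)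
    (h_lip : ∀ i : Fin N, ∃ L : NNReal, LipschitzWith L (S.h i)) (C : Coupling)
    {es : BlendedState N n q} {μ υ : ℝ} (hυ : 0 < υ) (hυμ : υ < μ)
    (h_blend : GloballyExpStable S.blended es μ) {κ kI : ℝ} (hκ : 0 < κ) (hkI : 0 < kI) :
    ∃ k₀ c₀ : ℝ, 0 < k₀ ∧ 0 < c₀ ∧ ∀ k s r : ℝ, k₀ < k → 0 < s → s ≤ k → 0 ≤ r → r ≤ μ - υ →
      r ≤ c₀ * s ^ 2 / k → GloballyExpStable (S.errorField C (s * κ) k (s * kI) es) 0 r := by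
  obtain ⟨L, hbl⟩ := exists_lipschitzWith_blended h_lip
  obtain ⟨M, hM⟩ : ∃ M, M = S.Wᵀ * S.Eᵀ * S.E * S.W := ⟨_, rfl⟩
  have hMt : (M * M)ᵀ = M * M := by rw [Matrix.transpose_mul, hM, gram_transpose]
  obtain ⟨a, ha, hcoer⟩ := h.exists_coercive h_conn C hκ hkI hM
  obtain ⟨B, hB, hcoup⟩ := exists_coupling_bound h_lip es
  obtain ⟨b, hb, hequiv⟩ := exists_norm_equiv h.isUnit_transpose N n
  obtain ⟨k₀, c₀, D, hk₀, hc₀, hD, hdec⟩ := exists_gain_interconnection_decay (L₁ := B) hbl h_blend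
    hυ hυμ (kronL S.lamP M) (kI • kronL (S.lamI C) 1) (κ • kronL S.lamP (M * M))
    (inner_smul_kronL_comm (lamI_transpose S C) transpose_one kI)
    (inner_smul_kronL_comm (lamP_transpose S) hMt κ) ha
    (fun x => (hcoer x).1) (fun x => (hcoer x).2.1) (fun x => (hcoer x).2.2)
  refine ⟨k₀, c₀, hk₀, hc₀, fun k s r hk hs hsk hr hrμ hrs => ?_⟩
  refine ⟨errorField_zero C _ _ _ h_blend.1, √(b * D * b), by positivity, fun γ hγ t ht => ?_⟩
  rw [sub_zero, sub_zero]
  have key := hdec k s r hk hs hsk hr hrμ hrs (fun τ => (γ τ).fst + es)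
    (fun τ => S.toBlended (S.hStack (S.xOf es (γ τ))) - S.blended ((γ τ).fst + es))
    (fun τ => (γ τ).snd.fst) (fun τ => kronL 1 (S.Wᵀ * S.Eᵀ) (γ τ).snd.snd)
    (fun τ => kron S.Rᵀ S.Wᵀ (S.hStack (S.xOf es (γ τ)) - S.hStack (S.xStar es)))
    (fun τ hτ => ?_) t ht
  · simp only [add_sub_cancel_right] at key
    have e1 := (hequiv (γ t)).1
    have e2 := (hequiv (γ 0)).2
    refine le_of_sq_le_sq ?_ (by positivity)
    rw [mul_pow, mul_pow, Real.sq_sqrt (by positivity), ← Real.exp_nat_mul]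
    have e3 : ((2 : ℕ) : ℝ) * (-r * t) = -(2 * r) * t := by push_cast; ring
    rw [e3]
    have e4 : 0 ≤ D * Real.exp (-(2 * r) * t) := by positivity
    calc ‖γ t‖ ^ 2 ≤ b * (D * Real.exp (-(2 * r) * t) * (b * ‖γ 0‖ ^ 2)) :=
          e1.trans (mul_le_mul_of_nonneg_left
            (key.trans (mul_le_mul_of_nonneg_left e2 e4)) hb.le)
      _ = _ := by ring
  · have hd := hγ τ hτ
    refine ⟨?_, ?_, ?_, ?_, ?_⟩
    · refine (hd.withLp_fst.add_const es).congr_deriv ?_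
      rw [errorField_fst, add_sub_cancel]
    · refine hd.withLp_snd.withLp_fst.congr_deriv ?_
      rw [errorField_snd_fst, mul_smul, _root_.smul_apply, kronL_apply, kronL_apply,
        kronL_apply, kron_kron, Matrix.mul_one, Matrix.one_mul, hM]
    · refine ((kronL 1 (S.Wᵀ * S.Eᵀ)).hasFDerivAt.comp_hasDerivWithinAt τ
        hd.withLp_snd.withLp_snd).congr_deriv ?_
      have hFK : S.Wᵀ * S.Eᵀ * (S.K * S.E * S.W) = M * M := by
        simp only [hM, K, Matrix.mul_assoc]
      rw [errorField_snd_snd, mul_smul, _root_.smul_apply, kronL_apply, kronL_apply,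
        kron_smul, kron_smul, kron_kron, Matrix.one_mul, hFK]
    · exact (hcoup (γ τ)).1
    · rw [add_sub_cancel_right]
      exact (hcoup (γ τ)).2

end MultiAgent

/-! ### From the coupled agents to the error system -/

namespace MultiAgent

variable {N n q : ℕ} {S : MultiAgent N n q}

theorem diffuse_eq {d : ℕ} (v : Fin N → EuclideanSpace ℝ (Fin d)) (i : Fin N) :
    S.diffuse v i = -∑ j, S.lap i j • v j := by
  classical
  ext k
  have h1 := SimpleGraph.lapMatrix_mulVec_apply (R := ℝ) S.graph i (fun j => v j k)
  have h2 : ∑ j, S.lap i j * v j k = (S.graph.degree i : ℝ) * v i k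
      - ∑ u ∈ S.graph.neighborFinset i, v u k := by
    rw [← h1]
    simp only [lap, Matrix.mulVec, dotProduct]
  have h3 : (S.diffuse v i) k = ∑ u ∈ S.graph.neighborFinset i, (v u k - v i k) := by
    simp only [diffuse, WithLp.ofLp_sum, Finset.sum_apply, WithLp.ofLp_sub]
    congr!
  rw [h3, Finset.sum_sub_distrib, Finset.sum_const, SimpleGraph.card_neighborFinset_eq_degree,
    nsmul_eq_mul, PiLp.neg_apply, WithLp.ofLp_sum, Finset.sum_apply]
  simp only [PiLp.smul_apply, smul_eq_mul]
  rw [h2]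
  ring

variable (S) in
/-- The matrix acting on `ξ` in the input: the Laplacian for (A), the identity for (B). -/
noncomputable def couplingMatrix : Coupling → Matrix (Fin N) (Fin N) ℝ
  | .A => S.lap
  | .B => 1

theorem IsAdapted.lamI_mul (h : S.IsAdapted) (C : Coupling) :
    S.lamI C * S.Rᵀ = S.Rᵀ * S.couplingMatrix C := by
  cases C
  · exact h.lamP_mul
  · simp [lamI, couplingMatrix]

variable (S) in
/-- The inputs of all agents before multiplication by `Eᵀ`. -/
noncomputable def outputInput (C : Coupling) (kP kI : ℝ) (x : Stack N n) (ξ : Stack N q) :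
    Stack N q :=
  -(kP • kron S.lap S.E x) - kI • kron (S.couplingMatrix C) 1 ξ

theorem diffuse_mv (x : Stack N n) (i : Fin N) :
    S.diffuse (fun j => mv S.E (x j)) i = -(kron S.lap S.E x i) := by
  rw [diffuse_eq, kron_apply]

theorem input_eq (C : Coupling) (kP kI : ℝ) (x : Stack N n) (ξ : Stack N q) (i : Fin N) :
    S.input C kP kI x ξ i = kron 1 S.Eᵀ (S.outputInput C kP kI x ξ) i := by
  have h1 : ∀ y : Stack N q, kron (1 : Matrix (Fin N) (Fin N) ℝ) S.Eᵀ y i = mv S.Eᵀ (y i) := by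
    intro y
    simp [kron_apply, Matrix.one_apply]
  rw [h1]
  have h2 : S.outputInput C kP kI x ξ i
      = -(kP • kron S.lap S.E x i) - kI • kron (S.couplingMatrix C) 1 ξ i := rfl
  rw [h2]
  cases C
  · have h3 : S.diffuse (fun j => ξ j) i = -(kron S.lap 1 ξ i) := by
      simp only [diffuse_eq, kron_apply, mv_one]
    simp only [input, diffuse_mv, h3, couplingMatrix, map_neg, map_sub, map_smul, smul_neg]
    abel
  · simp only [input, diffuse_mv, couplingMatrix, kron_one_one, map_neg, map_sub, map_smul,
      smul_neg]

theorem sum_kron_lap {m d : ℕ} (B : Matrix (Fin d) (Fin m) ℝ) (x : Stack N m) :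
    ∑ i, kron S.lap B x i = 0 := by
  simp only [kron_apply]
  rw [Finset.sum_comm]
  simp [← Finset.sum_smul, sum_lap_col]

theorem sum_outputInput (C : Coupling) (kP kI : ℝ) (x : Stack N n) {ξ : Stack N q}
    (hξ : C = .B → ∑ i, ξ i = 0) : ∑ i, S.outputInput C kP kI x ξ i = 0 := by
  have h1 : ∀ i, S.outputInput C kP kI x ξ i
      = -(kP • kron S.lap S.E x i) - kI • kron (S.couplingMatrix C) 1 ξ i := fun _ => rfl
  simp only [h1, Finset.sum_sub_distrib, Finset.sum_neg_distrib, ← Finset.smul_sum, sum_kron_lap]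
  cases C
  · simp only [couplingMatrix, sum_kron_lap]
    simp
  · simp only [couplingMatrix, kron_one_one, hξ rfl]
    simp

theorem IsAdapted.toBlended_input (h : S.IsAdapted) {g : Stack N q} (hg : ∑ i, g i = 0) :
    S.toBlended (kron 1 S.Eᵀ g) = 0 := by
  have h1 : ∀ i, kron (1 : Matrix (Fin N) (Fin N) ℝ) S.Eᵀ g i = mv S.Eᵀ (g i) := by
    intro i
    simp [kron_apply, Matrix.one_apply]
  have hZE : S.Zᵀ * S.Eᵀ = 0 := by rw [← Matrix.transpose_mul, h.mul_Z, transpose_zero]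
  refine WithLp.ofLp_injective 2 (Prod.ext ?_ ?_)
  · ext1 i
    change mv S.Zᵀ (kron 1 S.Eᵀ g i) = 0
    rw [h1, ← mv_mul, hZE, mv_zero_left]
  · change (1 / (N : ℝ)) • ∑ i, mv S.Wᵀ (kron 1 S.Eᵀ g i) = 0
    simp only [h1, ← map_sum, hg, map_zero, smul_zero]

theorem IsAdapted.kron_input (h : S.IsAdapted) (C : Coupling) (kP kI : ℝ) (x : Stack N n)
    (ξ : Stack N q) : kron S.Rᵀ S.Wᵀ (kron 1 S.Eᵀ (S.outputInput C kP kI x ξ)) =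
      -(kP • kron S.lamP (S.Wᵀ * S.Eᵀ * S.E * S.W) (kron S.Rᵀ S.Wᵀ x))
        - kI • kron (S.lamI C) (S.Wᵀ * S.Eᵀ) (kron S.Rᵀ 1 ξ) := by
  have hE : S.Wᵀ * S.Eᵀ * S.E * S.W * S.Wᵀ = S.Wᵀ * S.Eᵀ * S.E := by
    calc _ = S.Wᵀ * S.Eᵀ * (S.E * S.W * S.Wᵀ) := by simp only [Matrix.mul_assoc]
      _ = _ := by rw [h.E_eq]
  have hneg : ∀ y : Stack N q, kron S.Rᵀ (S.Wᵀ * S.Eᵀ) (-y) = -kron S.Rᵀ (S.Wᵀ * S.Eᵀ) y :=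
    fun y => map_neg (kronL S.Rᵀ (S.Wᵀ * S.Eᵀ)) y
  rw [kron_kron, Matrix.mul_one, outputInput, kron_sub, hneg, kron_smul, kron_smul, kron_kron,
    kron_kron, kron_kron, kron_kron, h.lamP_mul, h.lamI_mul, hE]

theorem IsAdapted.xOf_errorCoord (h : S.IsAdapted) (C : Coupling) (kI : ℝ)
    (es : BlendedState N n q) (x : Stack N n) (ξ : Stack N q) :
    S.xOf es (S.errorCoord C kI es x ξ) = x := by
  have h0 : (S.errorCoord C kI es x ξ).fst = S.toBlended x - es := rfl
  have h1 : (S.errorCoord C kI es x ξ).snd.fst = kron S.Rᵀ S.Wᵀ x := rfl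
  rw [xOf, h0, h1, sub_add_cancel, kron_kron]
  ext1 i
  change mv S.Z (mv S.Zᵀ (x i)) + mv S.W ((1 / (N : ℝ)) • ∑ j, mv S.Wᵀ (x j))
    + kron (S.R * S.Rᵀ) (S.W * S.Wᵀ) x i = x i
  simp only [kron_apply, h.R_mul_transpose, sub_smul, Finset.sum_sub_distrib, Matrix.one_apply,
    ite_smul, one_smul, zero_smul, Finset.sum_ite_eq, Finset.mem_univ, if_true, map_smul, map_sum,
    ← Finset.smul_sum, ← mv_mul]
  have h2 : mv (S.Z * S.Zᵀ) (x i) + mv (S.W * S.Wᵀ) (x i) = x i := by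
    rw [← mv_add_left, h.add_mul_transpose, mv_one]
  conv_rhs => rw [← h2]
  abel

theorem IsAdapted.kron_lamI_xiTildeStar (h : S.IsAdapted) (h_conn : S.graph.Connected)
    (C : Coupling) {kI : ℝ} (hkI : 0 < kI) (es : BlendedState N n q) :
    kI • kron (S.lamI C) (S.Wᵀ * S.Eᵀ) (S.xiTildeStar C kI es)
      = kron S.Rᵀ S.Wᵀ (S.hStack (S.xStar es)) := by
  have h1 := Matrix.mul_nonsing_inv (S.lamI C)
    ((Matrix.isUnit_iff_isUnit_det _).1 (h.lamI_posDef h_conn C).isUnit)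
  have h2 := Matrix.mul_nonsing_inv (S.Wᵀ * S.Eᵀ)
    ((Matrix.isUnit_iff_isUnit_det _).1 h.isUnit_transpose)
  rw [xiTildeStar, kron_smul, kron_kron, h1, h2, kron_one_one, smul_smul,
    mul_one_div_cancel hkI.ne', one_smul]

/-- For (B) the constraint `∑ ξ_i = 0` is preserved. -/
theorem IsTrajectory.sum_eq_zero {C : Coupling} {κ kP kI : ℝ} {x : ℝ → Stack N n}
    {ξ : ℝ → Stack N q} (h : S.IsTrajectory C κ kP kI x ξ) (hC : C = .B) {t : ℝ} (ht : 0 ≤ t) :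
    ∑ i, ξ t i = 0 := by
  have hd : ∀ s, 0 ≤ s → HasDerivWithinAt (fun s => ∑ i, ξ s i) 0 (Ici 0) s := by
    intro s hs
    have h1 := HasDerivWithinAt.fun_sum (u := Finset.univ) fun i _ => (h.1 s hs i).2
    refine h1.congr_deriv ?_
    have h2 : ∑ i, S.diffuse (fun j => mv S.E (x s j)) i = 0 := by
      simp only [diffuse_mv, Finset.sum_neg_distrib, sum_kron_lap, neg_zero]
    rw [Finset.sum_neg_distrib, ← Finset.smul_sum, ← map_sum, h2, map_zero, smul_zero, neg_zero]
  rw [← h.2 hC]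
  exact constant_of_has_deriv_right_zero (a := 0) (b := t)
    (fun s hs => (hd s hs.1).continuousWithinAt.mono Icc_subset_Ici_self)
    (fun s hs => (hd s hs.1).mono (Ici_subset_Ici.2 hs.1)) t ⟨ht, le_rfl⟩

/-- In the error coordinates a trajectory of the coupled agents solves the error system. -/
theorem IsAdapted.isIntegralCurveOn_errorCoord (h : S.IsAdapted) (h_conn : S.graph.Connected)
    {C : Coupling} {κ kP kI : ℝ} (hkI : 0 < kI) (es : BlendedState N n q) {x : ℝ → Stack N n}
    {ξ : ℝ → Stack N q} (hx : S.IsTrajectory C κ kP kI x ξ) :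
    IsIntegralCurveOn (fun t => S.errorCoord C kI es (x t) (ξ t))
      (fun _ => S.errorField C κ kP kI es) (Ici 0) := by
  intro t ht
  set u := S.outputInput C kP kI (x t) (ξ t) with hu
  have hdx := hasDerivWithinAt_piLp_two (f := x) (f' := S.hStack (x t) + kron 1 S.Eᵀ u)
    (A := Ici 0) (t := t) fun i =>
      (hx.1 t ht i).1.congr_deriv (by rw [input_eq, PiLp.add_apply]; rfl)
  have hdξ := hasDerivWithinAt_piLp_two (f := ξ) (f' := κ • kron 1 S.K (kron S.lap S.E (x t)))
    (A := Ici 0) (t := t) fun i =>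
      (hx.1 t ht i).2.congr_deriv (by
        rw [diffuse_mv, PiLp.smul_apply]
        simp [kron_apply 1, Matrix.one_apply])
  have h1 := (S.toBlended.hasFDerivAt.comp_hasDerivWithinAt t hdx).sub_const es
  have h2 := (kronL S.Rᵀ S.Wᵀ).hasFDerivAt.comp_hasDerivWithinAt t hdx
  have h3 := ((kronL S.Rᵀ (1 : Matrix (Fin q) (Fin q) ℝ)).hasFDerivAt.comp_hasDerivWithinAt t
    hdξ).sub_const (S.xiTildeStar C kI es)
  refine (h1.toLp_prodMk (h2.toLp_prodMk h3)).congr_deriv ?_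
  have hxt := h.xOf_errorCoord C kI es (x t) (ξ t)
  refine WithLp.ofLp_injective 2 (Prod.ext ?_ (WithLp.ofLp_injective 2 (Prod.ext ?_ ?_)))
  · change S.toBlended (S.hStack (x t) + kron 1 S.Eᵀ u) = WithLp.fst _
    rw [errorField_fst, hxt, map_add,
      h.toBlended_input (sum_outputInput C kP kI (x t) fun hC => hx.sum_eq_zero hC ht), add_zero]
  · change kron S.Rᵀ S.Wᵀ (S.hStack (x t) + kron 1 S.Eᵀ u) = WithLp.fst (WithLp.snd _)
    have e1 : (S.errorCoord C kI es (x t) (ξ t)).snd.fst = kron S.Rᵀ S.Wᵀ (x t) := rfl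
    have e2 : (S.errorCoord C kI es (x t) (ξ t)).snd.snd
        = kron S.Rᵀ 1 (ξ t) - S.xiTildeStar C kI es := rfl
    rw [errorField_snd_fst, hxt, e1, e2, kron_add, kron_sub, kron_sub, smul_sub,
      h.kron_lamI_xiTildeStar h_conn C hkI, hu, h.kron_input]
    abel
  · change kron S.Rᵀ 1 (κ • kron 1 S.K (kron S.lap S.E (x t))) = WithLp.snd (WithLp.snd _)
    have e1 : (S.errorCoord C kI es (x t) (ξ t)).snd.fst = kron S.Rᵀ S.Wᵀ (x t) := rfl
    have hE : S.K * S.E * S.W * S.Wᵀ = S.K * S.E := by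
      conv_rhs => rw [← h.E_eq]
      simp only [Matrix.mul_assoc]
    rw [errorField_snd_snd, e1, kron_smul, kron_kron, kron_kron, kron_kron, h.lamP_mul, hE,
      Matrix.mul_one, Matrix.one_mul]

theorem IsAdapted.trajectoriesConverge (h : S.IsAdapted) (h_conn : S.graph.Connected)
    {C : Coupling} {κ kP kI r : ℝ} (hkI : 0 < kI) {es : BlendedState N n q}
    (hstab : GloballyExpStable (S.errorField C κ kP kI es) 0 r) :
    S.TrajectoriesConverge C κ kP kI es r := by
  obtain ⟨-, c, hc, hdec⟩ := hstab
  set b : ℝ := ‖S.ofBlended‖ + ‖kronL S.R S.W‖ with hb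
  have hb0 : 0 ≤ b := add_nonneg (norm_nonneg _) (norm_nonneg _)
  refine ⟨(1 + b) * c, by positivity, fun x ξ hx t ht => ?_⟩
  have h1 := hdec _ (h.isIntegralCurveOn_errorCoord h_conn hkI es hx) t ht
  rw [sub_zero, sub_zero] at h1
  have h0 : 0 ≤ c * Real.exp (-r * t) * ‖S.errorCoord C kI es (x 0) (ξ 0)‖ := by positivity
  refine ⟨?_, fun i => ?_⟩
  · calc _ ≤ c * Real.exp (-r * t) * ‖S.errorCoord C kI es (x 0) (ξ 0)‖ := h1
      _ ≤ c * Real.exp (-r * t) * ‖S.errorCoord C kI es (x 0) (ξ 0)‖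
          + b * (c * Real.exp (-r * t) * ‖S.errorCoord C kI es (x 0) (ξ 0)‖) := by
        linarith [mul_nonneg hb0 h0]
      _ = _ := by ring
  · have h2 := norm_xOf_sub_le (S := S) es (S.errorCoord C kI es (x t) (ξ t))
    rw [h.xOf_errorCoord] at h2
    have h3 := norm_stack_apply_le (x t - S.xStar es) i
    have hf : ∀ v : ErrorState N n q, ‖v.fst‖ ≤ ‖v‖ ∧ ‖v.snd.fst‖ ≤ ‖v‖ := by
      intro v
      have e := norm_errorState_sq v
      constructor <;> refine le_of_sq_le_sq ?_ (norm_nonneg _) <;> rw [e] <;>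
        nlinarith [sq_nonneg ‖v.fst‖, sq_nonneg ‖v.snd.fst‖, sq_nonneg ‖v.snd.snd‖]
    have h4 := hf (S.errorCoord C kI es (x t) (ξ t))
    calc ‖x t i - S.xStar es i‖ ≤ ‖x t - S.xStar es‖ := h3
      _ ≤ ‖S.ofBlended‖ * ‖S.errorCoord C kI es (x t) (ξ t)‖
          + ‖kronL S.R S.W‖ * ‖S.errorCoord C kI es (x t) (ξ t)‖ :=
        h2.trans (add_le_add (mul_le_mul_of_nonneg_left h4.1 (norm_nonneg _))
          (mul_le_mul_of_nonneg_left h4.2 (norm_nonneg _)))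
      _ = b * ‖S.errorCoord C kI es (x t) (ξ t)‖ := by rw [hb]; ring
      _ ≤ b * (c * Real.exp (-r * t) * ‖S.errorCoord C kI es (x 0) (ξ 0)‖) := by gcongr
      _ ≤ b * (c * Real.exp (-r * t) * ‖S.errorCoord C kI es (x 0) (ξ 0)‖)
          + c * Real.exp (-r * t) * ‖S.errorCoord C kI es (x 0) (ξ 0)‖ := by linarith
      _ = _ := by ring

end MultiAgent

theorem theorem1 {N n q : ℕ} (S : MultiAgent N n q)
    (h_conn : S.graph.Connected)
    (h_lip : ∀ i : Fin N, ∃ L : NNReal, LipschitzWith L (S.h i))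
    (h_rank : S.E.rank = q)
    (h_Z : ColumnsONB S.Z (LinearMap.ker (Matrix.toEuclideanLin S.E)))
    (h_W : ColumnsONB S.W (LinearMap.ker (Matrix.toEuclideanLin S.E))ᗮ)
    (h_R : ColumnsONB S.R
      (LinearMap.ker (Matrix.toEuclideanLin (Matrix.of fun (_ : Fin 1) (_ : Fin N) => (1 : ℝ)))))
    (C : Coupling) (es : BlendedState N n q) (μ : ℝ) (h_mu : 0 < μ)
    (h_blend : GloballyExpStable S.blended es μ) :
    (∀ κ kI : ℝ, 0 < κ → 0 < kI → kI < 2 * κ →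
      ∃ kPs : ℝ, 0 < kPs ∧ ∀ kP : ℝ, kPs < kP →
        ∃ r : ℝ, 0 < r ∧
          GloballyExpStable (S.errorField C κ kP kI es) 0 r ∧
          S.TrajectoriesConverge C κ kP kI es r) ∧
    (∃ φ₀ : ℝ, 0 < φ₀ ∧ (2 ≤ N → 1 ≤ q → S.phiBound C ≤ φ₀) ∧
      ∀ φ : ℝ, 0 < φ → φ < φ₀ → ∀ υ : ℝ, 0 < υ → υ < μ →
        ∃ kPss : ℝ, 0 < kPss ∧ ∀ kP : ℝ, kPss < kP →
          GloballyExpStable (S.errorField C (φ * kP) kP (φ * kP) es) 0 (μ - υ) ∧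
          S.TrajectoriesConverge C (φ * kP) kP (φ * kP) es (μ - υ)) := by
  have hN : 0 < N := Fin.pos_iff_nonempty.2 h_conn.nonempty
  have h := MultiAgent.isAdapted_of_columnsONB hN h_rank h_Z h_W h_R
  constructor
  · intro κ kI hκ hkI _
    obtain ⟨k₀, c₀, hk₀, hc₀, hdec⟩ := h.exists_gain_errorField_decay h_conn h_lip C
      (half_pos h_mu) (half_lt_self h_mu) h_blend hκ hkI
    refine ⟨max k₀ 1, by positivity, fun kP hkP => ?_⟩
    have hk1 : 1 < kP := (le_max_right _ _).trans_lt hkP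
    have hk0 : 0 < kP := by linarith
    have hr : 0 < min (μ - μ / 2) (c₀ * 1 ^ 2 / kP) := lt_min (by linarith) (by positivity)
    have hs := hdec kP 1 _ ((le_max_left _ _).trans_lt hkP) one_pos hk1.le hr.le
      (min_le_left _ _) (min_le_right _ _)
    rw [one_mul, one_mul] at hs
    exact ⟨_, hr, hs, h.trajectoriesConverge h_conn hkI hs⟩
  · -- every ratio `φ > 0` is admissible, so `φ₀` may be any number above the explicit bound
    refine ⟨max 1 (S.phiBound C), by positivity, fun _ _ => le_max_right _ _,
      fun φ hφ _ υ hυ hυμ => ?_⟩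
    obtain ⟨k₀, c₀, hk₀, hc₀, hdec⟩ := h.exists_gain_errorField_decay h_conn h_lip C
      hυ hυμ h_blend hφ hφ
    refine ⟨max k₀ ((μ - υ) / c₀), lt_max_of_lt_left hk₀, fun kP hkP => ?_⟩
    have hk : k₀ < kP := (le_max_left _ _).trans_lt hkP
    have hk0 : 0 < kP := hk₀.trans hk
    have hk' : (μ - υ) / c₀ ≤ kP := ((le_max_right _ _).trans_lt hkP).le
    have hrs : μ - υ ≤ c₀ * kP ^ 2 / kP := by
      rw [div_le_iff₀ hc₀] at hk'
      rw [sq, ← mul_assoc, mul_div_cancel_right₀ _ hk0.ne']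
      linarith
    have hs := hdec kP kP (μ - υ) hk hk0 le_rfl (by linarith) le_rfl hrs
    rw [mul_comm kP φ] at hs
    exact ⟨hs, h.trajectoriesConverge h_conn (by positivity) hs⟩
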